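/- Consider an asynchronous system of $n>1$ processes connected by a complete graph of reliable FIFO channels with authenticated links (each message is eventually delivered, but there is no bound on message delays or relative speeds), in which at most $f$ processes are Byzantine faulty, i.e. behave arbitrarily. Every process $p_i$ has an input ${\bf x}_i\in{\bf R}^d$, $d\ge 1$. Let $\epsilon>0$, and assume that known reals $\nu$ and $U$ bound all coordinates of the inputs of the non-faulty processes from below and above. If $n\ge (d+2)f+1$, then approximate Byzantine vector consensus is achievable: there is a deterministic protocol such that, in every admissible execution, (Termination) every non-faulty process irrevocably decides on a vector after finitely many steps, ($\epsilon$-Agreement) for $1\le l\le d$ the $l$-th coordinates of the decisions of any two non-faulty processes are within $\epsilon$ of each other, and (Validity) the decision of each non-faulty process is in the convex hull of the inputs of the non-faulty processes. More precisely, for a multiset $Y$ of points let $\Gamma(Y)$ be the intersection of the convex hulls of all sub-multisets of $Y$ of size $|Y|-f$; for a set $C$ of tuples $(p_k,{\bf w}_k,t)$ (a process, a point of ${\bf R}^d$, a round number) let $\Phi(C)$ be the multiset of the points ${\bf w}_k$; and put $\gamma=\frac{1}{n\binom{n}{n-f}}$ and $R=\max\bigl(0,\,1+\lceil\log_{1/(1-\gamma)}\frac{U-\nu}{\epsilon}\rceil\bigr)$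 (if $U=\nu$, the logarithm is read as $0$). For every function that selects a point ${\bf z}_C\in\Gamma(\Phi(C))$ for each finite set $C$ of tuples with $\Gamma(\Phi(C))\ne\emptyset$, the protocol can be chosen so that each non-faulty process $p_i$ performs exactly the rounds $1,\dots,R$, with state ${\bf v}_i[t]$ at the end of round $t$ and ${\bf v}_i[0]={\bf x}_i$, decides ${\bf v}_i[R]$ at the end of round $R$, and for each round $1\le t\le R$: - each non-faulty $p_i$ obtains a set $B_i[t]$ of at least $n-f$ tuples with round number $t$, such that $|B_i[t]\cap B_j[t]|\ge n-f$ for all non-faulty $p_i,p_j$; $B_i[t]$ contains at most one tuple for each process; and ${\bf w}_k={\bf v}_k[t-1]$ whenever $(p_k,{\bf w}_k,t)\in B_i[t]$ with $p_k$ non-faulty; - for each non-faulty $p_i$ and each $C\subseteq B_i[t]$ with $|C|=n-f$, ${\bf z}_C\in\Gamma(\Phi(C))$, and ${\bf v}_i[t]$ is the average of the points ${\bf z}_C$ (with multiplicity) over all such $C$; - each ${\bf v}_i[t]$ with $p_i$ non-faulty is in the convex hull of the states ${\bf v}_k[t-1]$ of the non-faulty $p_k$; - for $1\le l\le d$, $\Omega_l[t]-\mu_l[t]\le(1-\gamma)\,(\Omega_l[t-1]-\mu_l[t-1])$,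 where $\Omega_l[t]$ and $\mu_l[t]$ are the maximum and the minimum of the $l$-th coordinates of ${\bf v}_k[t]$ over the non-faulty $p_k$. -/

import Mathlib

namespace BVC

/-! ### Asynchronous message passing with Byzantine faults -/

/-- A deterministic protocol for `n` processes with inputs and decisions in `V`.
A process knows its own index and its own input.  In one step it receives at most one message
(together with the identity of the sender), changes its local state, and sends finitely many
messages to each process.  `decision s` is the decision made so far in local state `s`. -/
structure Protocol (n : ℕ) (V : Type) where
  Msg : Type
  State : Type
  init : Fin n → V → State
  step : Fin n → State → Option (Fin n × Msg) → State × (Fin n → List Msg)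
  decision : State → Option V

variable {n : ℕ} {V : Type}

/-- A global configuration: all local states and the contents of all channels;
`chan j i` is the queue of messages in transit from `j` to `i`, oldest first. -/
structure Config (P : Protocol n V) where
  state : Fin n → P.State
  chan : Fin n → Fin n → List P.Msg

/-- A step of one process: who acts, what is received (sender and message, or nothing),
the new local state, and the messages sent to each process. -/
structure Action (P : Protocol n V) where
  actor : Fin n
  received : Option (Fin n × P.Msg)
  newState : P.State
  sent : Fin n → List P.Msg

/-- `q` is what remains in the channels after process `i` has received `r`:
a received message is the oldest one of its channel, and it is removed. -/
def Receives {P : Protocol n V} (c : Config P) (i : Fin n) (r : Option (Fin n × P.Msg))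
    (q : Fin n → Fin n → List P.Msg) : Prop :=
  match r with
  | none => q = c.chan
  | some (j, m) =>
      c.chan j i = m :: q j i ∧ ∀ a b : Fin n, (a, b) ≠ (j, i) → q a b = c.chan a b

/-- One step of the system when `F` is the set of faulty processes.  A non-faulty process follows
the protocol; the new state of a faulty process and the messages that it sends are arbitrary.
Channels are reliable and FIFO, and the identity of the sender cannot be forged. -/
def IsStep (P : Protocol n V) (F : Finset (Fin n)) (c : Config P) (a : Action P)
    (c' : Config P) : Prop :=
  (a.actor ∉ F → (a.newState, a.sent) = P.step a.actor (c.state a.actor) a.received) ∧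
  c'.state = Function.update c.state a.actor a.newState ∧
  ∃ q : Fin n → Fin n → List P.Msg, Receives c a.actor a.received q ∧
    ∀ j i : Fin n, c'.chan j i = if j = a.actor then q j i ++ a.sent i else q j i

/-- An infinite sequence of configurations and of the steps between them. -/
structure Execution (P : Protocol n V) where
  config : ℕ → Config P
  action : ℕ → Action P

/-- The admissible asynchronous executions with faulty set `F` and input vectors `x`: there is no
bound on relative speeds or delays, but each non-faulty process takes infinitely many steps and
each message sent to a non-faulty process is eventually received. -/
structure Admissible (P : Protocol n V) (F : Finset (Fin n)) (x : Fin n → V)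
    (e : Execution P) : Prop where
  init_state : ∀ i, i ∉ F → (e.config 0).state i = P.init i (x i)
  init_chan : ∀ j i, (e.config 0).chan j i = []
  step : ∀ k, IsStep P F (e.config k) (e.action k) (e.config (k + 1))
  fair_step : ∀ i, i ∉ F → ∀ k, ∃ k', k ≤ k' ∧ (e.action k').actor = i
  fair_receive : ∀ i, i ∉ F → ∀ j k, (e.config k).chan j i ≠ [] →
    ∃ k', k ≤ k' ∧ (e.action k').actor = i ∧ ∃ m, (e.action k').received = some (j, m)

/-- Process `i` decides `y` after finitely many steps; the decision is made once, for ever. -/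
def Decides {P : Protocol n V} (e : Execution P) (i : Fin n) (y : V) : Prop :=
  ∃ k₀, (∀ k < k₀, P.decision ((e.config k).state i) = none) ∧
    ∀ k, k₀ ≤ k → P.decision ((e.config k).state i) = some y

/-! ### Approximate Byzantine vector consensus -/

/-- Points of `d`-dimensional Euclidean space. -/
abbrev Pt (d : ℕ) : Type := EuclideanSpace ℝ (Fin d)

/-- The values `v i` at the non-faulty processes `i`. -/
def nonfaulty {d : ℕ} (F : Finset (Fin n)) (v : Fin n → Pt d) : Set (Pt d) :=
  {p | ∃ i, i ∉ F ∧ v i = p}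

/-- All coordinates of the inputs of the non-faulty processes lie between `ν` and `U`. -/
def InputsBounded {d : ℕ} (ν U : ℝ) (F : Finset (Fin n)) (x : Fin n → Pt d) : Prop :=
  ∀ i, i ∉ F → ∀ l, ν ≤ x i l ∧ x i l ≤ U

/-- `P` achieves approximate Byzantine vector consensus with parameter `ε` in the asynchronous
system, in the presence of at most `f` Byzantine processes, for inputs bounded by `ν` and `U`. -/
def SolvesApproxBVC {d : ℕ} (P : Protocol n (Pt d)) (f : ℕ) (ε ν U : ℝ) : Prop :=
  ∀ F : Finset (Fin n), F.card ≤ f → ∀ x : Fin n → Pt d, InputsBounded ν U F x →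
    ∀ e : Execution P, Admissible P F x e →
      ∃ y : Fin n → Pt d,
        -- termination
        (∀ i, i ∉ F → Decides e i (y i)) ∧
        -- agreement up to `ε`
        (∀ i, i ∉ F → ∀ j, j ∉ F → ∀ l, |y i l - y j l| ≤ ε) ∧
        -- validity
        (∀ i, i ∉ F → y i ∈ convexHull ℝ (nonfaulty F x))

/-! ### The round structure of the algorithm -/

/-- `Γ(Y)`: the intersection of the convex hulls of all sub-multisets of `Y` of size `|Y| - f`. -/
def Gam {d : ℕ} (f : ℕ) (Y : Multiset (Pt d)) : Set (Pt d) :=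
  {p | ∀ T : Multiset (Pt d), T ≤ Y → T.card = Y.card - f → p ∈ convexHull ℝ {z | z ∈ T}}

/-- A tuple `(p_k, w_k, t)`: a process, a point and a round number. -/
structure Tup (n d : ℕ) where
  proc : Fin n
  pt : Pt d
  round : ℕ

/-- `Φ(C)`: the multiset of the points of the tuples in `C`. -/
def Phi {d : ℕ} (C : Finset (Tup n d)) : Multiset (Pt d) := C.val.map Tup.pt

open Classical in
/-- The guarantees of the exchange mechanism in round `t`: from the states `u` at the start of the
round, each non-faulty process `i` obtains a set `B i` of at least `n - f` tuples of round `t`. -/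
structure Exchange {d : ℕ} (f : ℕ) (F : Finset (Fin n)) (t : ℕ) (u : Fin n → Pt d)
    (B : Fin n → Finset (Tup n d)) : Prop where
  round_eq : ∀ i, i ∉ F → ∀ τ ∈ B i, τ.round = t
  card_ge : ∀ i, i ∉ F → n - f ≤ (B i).card
  overlap : ∀ i, i ∉ F → ∀ j, j ∉ F → n - f ≤ (B i ∩ B j).card
  unique : ∀ i, i ∉ F → ∀ τ ∈ B i, ∀ σ ∈ B i, τ ≠ σ → τ.proc ≠ σ.proc
  correct : ∀ i, i ∉ F → ∀ τ ∈ B i, τ.proc ∉ F → τ.pt = u τ.proc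

/-- The average of the selected points `sel C` over all `C ⊆ B` with `|C| = n - f`
(counted with multiplicity). -/
noncomputable def average {d : ℕ} (f : ℕ) (sel : Finset (Tup n d) → Pt d)
    (B : Finset (Tup n d)) : Pt d :=
  ((B.powersetCard (n - f)).card : ℝ)⁻¹ • ∑ C ∈ B.powersetCard (n - f), sel C

/-- `γ = 1 / (n * (n choose (n - f)))`. -/
noncomputable def gam (n f : ℕ) : ℝ := 1 / ((n : ℝ) * (n.choose (n - f) : ℝ))

/-- The number of rounds `1 + ⌈log_{1/(1-γ)} ((U - ν)/ε)⌉` (no rounds if this is negative). -/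
noncomputable def numRounds (n f : ℕ) (ε ν U : ℝ) : ℕ :=
  (1 + ⌈Real.logb (1 / (1 - gam n f)) ((U - ν) / ε)⌉).toNat

/-- `Ω_l - μ_l`: the difference of the maximum and the minimum of the `l`-th coordinates of the
states of the non-faulty processes. -/
noncomputable def spread {d : ℕ} (F : Finset (Fin n)) (v : Fin n → Pt d) (l : Fin d) : ℝ :=
  (⨆ i : {i // i ∉ F}, v i l) - ⨅ i : {i // i ∉ F}, v i l

/-- In the execution `e`, process `i` performs exactly the rounds `1, …, R`, one after the other,
and then decides its state at the end of round `R`.  Here `hist s` is the list, kept in the local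
state `s`, of the pairs (set obtained, new state) of the rounds completed so far; `B t` and `v t`
are the set obtained in round `t` and the state at the end of round `t`, and `r k` is the number of
rounds completed before the `k`-th step of the execution. -/
def PerformsRounds {d : ℕ} {P : Protocol n (Pt d)}
    (hist : P.State → List (Finset (Tup n d) × Pt d)) (e : Execution P) (i : Fin n) (R : ℕ)
    (B : ℕ → Finset (Tup n d)) (v : ℕ → Pt d) : Prop :=
  ∃ r : ℕ → ℕ, r 0 = 0 ∧ Monotone r ∧ (∀ k, r k ≤ R) ∧ (∃ k, r k = R) ∧
    (∀ k, hist ((e.config k).state i) =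
      (List.range (r k)).map fun t => (B (t + 1), v (t + 1))) ∧
    ∀ k, P.decision ((e.config k).state i) = if r k = R then some (v R) else none

end BVC

open BVC

/-!
# Approximate Byzantine vector consensus in asynchronous systems

Each round consists of an exchange of the current states and of an averaging step.

*The exchange.*  Each process spreads its state by reliable broadcast: the state is echoed, `n - f`
echoes or `f + 1` `ready` votes for a value lead to a `ready` vote for it, and `n - f` `ready` votes
to its acceptance.  Two quorums of `n - f` processes share a non-faulty one because `3 f < n`, so all
`ready` votes of non-faulty processes for a broadcast agree (`Run.ready_unique`), they are for the
true state if the sender is non-faulty (`Run.ready_correct`), and what one non-faulty process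
accepts all of them accept in the end (`Run.eventually_accepted`).  Each process reports the first
`n - f` or more tuples that it accepts, and completes the round when it has accepted all tuples of
the reports of `n - f` processes, its witnesses.  Two non-faulty processes share a non-faulty
witness, hence `n - f` tuples (`Run.exchange`); and they complete each round, because the reports of
all non-faulty processes arrive and their tuples become accepted (`Run.eventually_completes`).

*The messages.*  All claims of a process form its board, and a message is a copy of the whole board.
Boards of non-faulty processes only grow and the channels are FIFO, so it suffices to remember the
last board received from each process: for a non-faulty sender it is a lower bound of the present
board, and it passes every given board of the sender in the end.  `Admissible.run` extracts from an
execution just these facts, and the rest of the proof depends on nothing else.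

*The averaging.*  By Helly's theorem `Γ` of `n - f ≥ (d + 1) f + 1` points is nonempty
(`gam_nonempty`).  It lies in the convex hull of the states of the non-faulty processes, since at
most `f` of the tuples are faulty (`mem_convexHull_of_mem_gam`), which gives validity.  A set of
`n - f` tuples common to two processes contributes the same point to both averages, with weight at
least `1 / (n choose (n - f)) ≥ γ`, so the spread shrinks by the factor `1 - γ`
(`Exchange.spread_average_le`), and the number of rounds is chosen to bring it below `ε`
(`pow_numRounds_mul_le`).
-/

namespace BVC

/-! ### The safe area and the contraction of one round -/

/-- If the parts of `Y` missed by the sub-multisets `T i` are together smaller than `Y`, then some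
element of `Y` belongs to every `T i`. -/
theorem exists_forall_mem_of_sum_card_sub_lt {ι α : Type*} [DecidableEq α] {I : Finset ι}
    {T : ι → Multiset α} {Y : Multiset α}
    (h : ∑ i ∈ I, (Y - T i).card < Y.card) : ∃ p, ∀ i ∈ I, p ∈ T i := by
  by_contra! hc
  refine absurd h (not_lt.mpr ?_)
  rw [← Multiset.card_sum]
  refine Multiset.card_le_card (Multiset.le_iff_count.mpr fun p => ?_)
  obtain ⟨i, hi, hp⟩ := hc p
  rw [Multiset.count_sum']
  refine le_trans ?_ (Finset.single_le_sum (f := fun i => Multiset.count p (Y - T i))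
    (fun _ _ => Nat.zero_le _) hi)
  rw [Multiset.count_sub, Multiset.count_eq_zero_of_notMem hp, Nat.sub_zero]

/-- By Helly's theorem `Γ(Y)` is nonempty once `Y` has more than `(d + 1) f` points: any `d + 1` of
the sub-multisets in question together miss at most `(d + 1) f` points of `Y`. -/
theorem gam_nonempty {d f : ℕ} {Y : Multiset (Pt d)} (h : (d + 1) * f + 1 ≤ Y.card) :
    (Gam f Y).Nonempty := by
  classical
  let s : Finset (Multiset (Pt d)) := (Y.powerset.toFinset).filter fun T => T.card = Y.card - f
  have hs : ∀ T, T ∈ s ↔ T ≤ Y ∧ T.card = Y.card - f := fun T => by simp [s]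
  obtain ⟨p, hp⟩ := Convex.helly_theorem' (𝕜 := ℝ) (s := s)
    (F := fun T : Multiset (Pt d) => convexHull ℝ {z | z ∈ T})
    (fun _ _ => convex_convexHull ℝ _) (by
      intro I hI hcard
      rw [finrank_euclideanSpace_fin] at hcard
      obtain ⟨p, hp⟩ := exists_forall_mem_of_sum_card_sub_lt (I := I) (T := id) (Y := Y) (by
        calc ∑ T ∈ I, (Y - id T).card ≤ ∑ _T ∈ I, f := Finset.sum_le_sum fun T hT => by
              obtain ⟨h1, h2⟩ := (hs T).1 (hI hT)
              rw [id, Multiset.card_sub h1]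
              omega
          _ = I.card * f := by simp
          _ ≤ (d + 1) * f := Nat.mul_le_mul_right f hcard
          _ < Y.card := h)
      exact ⟨p, Set.mem_iInter₂.2 fun T hT => subset_convexHull ℝ _ (hp T hT)⟩)
  rw [Set.mem_iInter₂] at hp
  exact ⟨p, fun T hT hc => hp T ((hs T).2 ⟨hT, hc⟩)⟩

section Round

variable {n d f : ℕ} {F : Finset (Fin n)}

/-- At most `f` of the tuples of `C` come from faulty processes, so the other ones contain a
sub-multiset of size `|C| - f`. -/
theorem mem_convexHull_of_mem_gam {C : Finset (Tup n d)} {u : Fin n → Pt d} {z : Pt d}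
    (hF : F.card ≤ f) (huniq : ∀ τ ∈ C, ∀ σ ∈ C, τ ≠ σ → τ.proc ≠ σ.proc)
    (hcor : ∀ τ ∈ C, τ.proc ∉ F → τ.pt = u τ.proc) (hz : z ∈ Gam f (Phi C)) :
    z ∈ convexHull ℝ (nonfaulty F u) := by
  classical
  have hbad : (C.filter fun τ => τ.proc ∈ F).card ≤ F.card :=
    Finset.card_le_card_of_injOn Tup.proc (fun τ hτ => by simpa using (Finset.mem_filter.1 hτ).2)
      fun τ hτ σ hσ hp => by
        by_contra hne
        exact huniq τ (Finset.mem_filter.1 hτ).1 σ (Finset.mem_filter.1 hσ).1 hne hp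
  have hsum := Finset.card_filter_add_card_filter_not (s := C) fun τ => τ.proc ∈ F
  obtain ⟨D, hD, hDc⟩ := Finset.exists_subset_card_eq
    (s := C.filter fun τ => τ.proc ∉ F) (n := C.card - f) (by omega)
  have hPhi : (Phi C).card = C.card := by simp [Phi]
  refine convexHull_mono ?_ (hz (Phi D) ?_ ?_)
  · intro p hp
    simp only [Phi, Set.mem_ofPred_eq, Multiset.mem_map, Finset.mem_val] at hp
    obtain ⟨τ, hτ, rfl⟩ := hp
    obtain ⟨h1, h2⟩ := Finset.mem_filter.1 (hD hτ)
    exact ⟨τ.proc, h2, (hcor τ h1 h2).symm⟩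
  · exact Multiset.map_le_map (Finset.val_le_iff.2 (hD.trans (Finset.filter_subset _ _)))
  · rw [hPhi, ← hDc]
    simp [Phi]

theorem average_mem {sel : Finset (Tup n d) → Pt d} {B : Finset (Tup n d)} {K : Set (Pt d)}
    (hK : Convex ℝ K) (hB : n - f ≤ B.card)
    (hsel : ∀ C ⊆ B, C.card = n - f → sel C ∈ K) : average f sel B ∈ K := by
  have hpos : 0 < ((B.powersetCard (n - f)).card : ℝ) := by
    rw [Finset.card_powersetCard]
    exact_mod_cast Nat.choose_pos hB
  rw [average, Finset.smul_sum]
  refine hK.sum_mem (fun _ _ => (inv_pos.2 hpos).le) ?_ fun C hC => ?_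
  · rw [Finset.sum_const, nsmul_eq_mul, mul_inv_cancel₀ hpos.ne']
  · obtain ⟨h1, h2⟩ := Finset.mem_powersetCard.1 hC
    exact hsel C h1 h2

theorem average_apply (sel : Finset (Tup n d) → Pt d) (B : Finset (Tup n d)) (l : Fin d) :
    average f sel B l =
      ((B.powersetCard (n - f)).card : ℝ)⁻¹ * ∑ C ∈ B.powersetCard (n - f), sel C l := by
  simp [average]

/-- An average of at most `N` numbers below `M`, one of them `a i`, is at most
`M - (M - a i) / N`. -/
theorem avg_le_sub {ι : Type*} {s : Finset ι} {a : ι → ℝ} {M N : ℝ} {i : ι} (hi : i ∈ s)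
    (hM : ∀ j ∈ s, a j ≤ M) (hN : (s.card : ℝ) ≤ N) :
    (s.card : ℝ)⁻¹ * ∑ j ∈ s, a j ≤ M - (M - a i) / N := by
  have hpos : 0 < (s.card : ℝ) := by exact_mod_cast Finset.card_pos.2 ⟨i, hi⟩
  have h1 : M - a i ≤ ∑ j ∈ s, (M - a j) :=
    Finset.single_le_sum (f := fun j => M - a j) (fun j hj => sub_nonneg.2 (hM j hj)) hi
  have h2 : ∑ j ∈ s, (M - a j) = s.card * M - ∑ j ∈ s, a j := by
    rw [Finset.sum_sub_distrib, Finset.sum_const, nsmul_eq_mul]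
  have h3 : (M - a i) / N ≤ (M - a i) / s.card :=
    div_le_div_of_nonneg_left (sub_nonneg.2 (hM i hi)) hpos hN
  have h4 : (M - a i) / s.card ≤ M - (s.card : ℝ)⁻¹ * ∑ j ∈ s, a j := by
    rw [div_le_iff₀ hpos, sub_mul, mul_comm (s.card : ℝ)⁻¹, mul_assoc, inv_mul_cancel₀ hpos.ne']
    linarith
  linarith

theorem le_avg_add {ι : Type*} {s : Finset ι} {a : ι → ℝ} {m N : ℝ} {i : ι} (hi : i ∈ s)
    (hm : ∀ j ∈ s, m ≤ a j) (hN : (s.card : ℝ) ≤ N) :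
    m + (a i - m) / N ≤ (s.card : ℝ)⁻¹ * ∑ j ∈ s, a j := by
  have h := avg_le_sub (a := fun j => -a j) (M := -m) hi (fun j hj => neg_le_neg (hm j hj)) hN
  rw [Finset.sum_neg_distrib, mul_neg] at h
  have : (-m - -a i) / N = (a i - m) / N := by ring
  linarith

theorem le_sup_spread {v : Fin n → Pt d} {i : Fin n} (hi : i ∉ F) (l : Fin d) :
    v i l ≤ ⨆ i : {i // i ∉ F}, v i l :=
  le_ciSup (f := fun i : {i // i ∉ F} => v i l) (Set.finite_range _).bddAbove ⟨i, hi⟩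

theorem inf_spread_le {v : Fin n → Pt d} {i : Fin n} (hi : i ∉ F) (l : Fin d) :
    ⨅ i : {i // i ∉ F}, v i l ≤ v i l :=
  ciInf_le (f := fun i : {i // i ∉ F} => v i l) (Set.finite_range _).bddBelow ⟨i, hi⟩

theorem abs_sub_le_spread {v : Fin n → Pt d} {i j : Fin n} (hi : i ∉ F) (hj : j ∉ F)
    (l : Fin d) : |v i l - v j l| ≤ spread F v l := by
  have h1 := le_sup_spread (v := v) hi l
  have h2 := le_sup_spread (v := v) hj l
  have h3 := inf_spread_le (v := v) hi l
  have h4 := inf_spread_le (v := v) hj l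
  rw [spread, abs_le]
  constructor <;> linarith

/-- The supremum and the infimum in `spread` are attained, as long as some process is
non-faulty. -/
theorem spread_le {v : Fin n → Pt d} {l : Fin d} {c : ℝ} (hF : ∃ i, i ∉ F)
    (h : ∀ i, i ∉ F → ∀ j, j ∉ F → v i l - v j l ≤ c) : spread F v l ≤ c := by
  obtain ⟨i₀, hi₀⟩ := hF
  have : Nonempty {i // i ∉ F} := ⟨⟨i₀, hi₀⟩⟩
  obtain ⟨i, hi⟩ := exists_eq_ciSup_of_finite (f := fun i : {i // i ∉ F} => v i l)
  obtain ⟨j, hj⟩ := exists_eq_ciInf_of_finite (f := fun i : {i // i ∉ F} => v i l)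
  rw [spread, ← hi, ← hj]
  exact h i i.2 j j.2

theorem mem_Icc_of_mem_convexHull {u : Fin n → Pt d} {z : Pt d}
    (hz : z ∈ convexHull ℝ (nonfaulty F u)) (l : Fin d) :
    z l ∈ Set.Icc (⨅ i : {i // i ∉ F}, u i l) (⨆ i : {i // i ∉ F}, u i l) := by
  have hlin : IsLinearMap ℝ fun p : Pt d => p l := ⟨fun _ _ => rfl, fun _ _ => rfl⟩
  refine convexHull_min ?_ ((convex_Icc _ _).is_linear_preimage hlin) hz
  rintro _ ⟨i, hi, rfl⟩
  exact ⟨inf_spread_le hi l, le_sup_spread hi l⟩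

theorem sel_mem_gam {sel : Finset (Tup n d) → Pt d}
    (hsel : ∀ C, (Gam f (Phi C)).Nonempty → sel C ∈ Gam f (Phi C))
    (hnf : (d + 2) * f + 1 ≤ n) {C : Finset (Tup n d)} (hC : C.card = n - f) :
    sel C ∈ Gam f (Phi C) := by
  refine hsel C (gam_nonempty ?_)
  rw [Phi, Multiset.card_map, Finset.card_val, hC]
  have : (d + 2) * f = (d + 1) * f + f := by ring
  omega

theorem Exchange.sel_mem_convexHull {t : ℕ} {u : Fin n → Pt d} {B : Fin n → Finset (Tup n d)}
    {sel : Finset (Tup n d) → Pt d} (hB : Exchange f F t u B) (hF : F.card ≤ f)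
    {i : Fin n} (hi : i ∉ F) {C : Finset (Tup n d)} (hC : C ⊆ B i)
    (hz : sel C ∈ Gam f (Phi C)) : sel C ∈ convexHull ℝ (nonfaulty F u) :=
  mem_convexHull_of_mem_gam hF (fun τ hτ σ hσ => hB.unique i hi τ (hC hτ) σ (hC hσ))
    (fun τ hτ => hB.correct i hi τ (hC hτ)) hz

theorem Exchange.card_le {t : ℕ} {u : Fin n → Pt d} {B : Fin n → Finset (Tup n d)}
    (hB : Exchange f F t u B) {i : Fin n} (hi : i ∉ F) : (B i).card ≤ n := by
  have h := Finset.card_le_card_of_injOn (s := B i) (t := Finset.univ) Tup.proc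
    (fun _ _ => Finset.mem_coe.2 (Finset.mem_univ _)) fun τ hτ σ hσ hp => by
      by_contra hne
      exact hB.unique i hi τ hτ σ hσ hne hp
  simpa using h

/-- Two non-faulty processes share some `C` of `n - f` tuples, hence the selected point of `C`,
which carries weight at least `1 / (n choose (n - f)) ≥ γ` in both averages. -/
theorem Exchange.spread_average_le {t : ℕ} {u v : Fin n → Pt d} {B : Fin n → Finset (Tup n d)}
    {sel : Finset (Tup n d) → Pt d} (hB : Exchange f F t u B) (hF : ∃ i, i ∉ F)
    (hsel : ∀ i, i ∉ F → ∀ C ⊆ B i, C.card = n - f → sel C ∈ convexHull ℝ (nonfaulty F u))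
    (hv : ∀ i, i ∉ F → v i = average f sel (B i)) (l : Fin d) :
    spread F v l ≤ (1 - gam n f) * spread F u l := by
  classical
  refine spread_le hF fun i hi j hj => ?_
  have hcommon : n - f ≤ (B i ∩ B j).card := by
    convert hB.overlap i hi j hj
  obtain ⟨C, hC, hCc⟩ := Finset.exists_subset_card_eq hcommon
  have hCi : C ⊆ B i := hC.trans Finset.inter_subset_left
  have hCj : C ⊆ B j := hC.trans Finset.inter_subset_right
  set N : ℝ := (n.choose (n - f) : ℝ) with hN
  have hNpos : 0 < N := Nat.cast_pos.2 (Nat.choose_pos (Nat.sub_le n f))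
  have hcard : ∀ a, a ∉ F → (((B a).powersetCard (n - f)).card : ℝ) ≤ N := fun a ha => by
    rw [Finset.card_powersetCard, hN]
    exact_mod_cast Nat.choose_le_choose _ (hB.card_le ha)
  have hmem : ∀ a, a ∉ F → ∀ D ∈ (B a).powersetCard (n - f),
      sel D l ∈ Set.Icc (⨅ i : {i // i ∉ F}, u i l) (⨆ i : {i // i ∉ F}, u i l) :=
    fun a ha D hD => by
      obtain ⟨h1, h2⟩ := Finset.mem_powersetCard.1 hD
      exact mem_Icc_of_mem_convexHull (hsel a ha D h1 h2) l
  have h1 := avg_le_sub (a := fun D => sel D l) (Finset.mem_powersetCard.2 ⟨hCi, hCc⟩)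
    (fun D hD => (hmem i hi D hD).2) (hcard i hi)
  have h2 := le_avg_add (a := fun D => sel D l) (Finset.mem_powersetCard.2 ⟨hCj, hCc⟩)
    (fun D hD => (hmem j hj D hD).1) (hcard j hj)
  rw [← average_apply, ← hv i hi] at h1
  rw [← average_apply, ← hv j hj] at h2
  have hspread : 0 ≤ spread F u l := le_trans (abs_nonneg _) (abs_sub_le_spread hi hi l)
  have hgam : gam n f ≤ 1 / N := by
    rw [gam]
    have hn : (1 : ℝ) ≤ n := by exact_mod_cast (Nat.succ_le_of_lt i.pos)
    exact one_div_le_one_div_of_le hNpos (le_mul_of_one_le_left hNpos.le hn)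
  have h3 := mul_le_mul_of_nonneg_right hgam hspread
  have h4 : 1 / N * spread F u l = ((⨆ i : {i // i ∉ F}, u i l) - sel C l) / N
      + (sel C l - ⨅ i : {i // i ∉ F}, u i l) / N := by
    rw [spread]; ring
  rw [sub_mul, one_mul]
  rw [spread] at h3 h4 ⊢
  linarith

/-! ### The number of rounds -/

theorem gam_pos (hn : 1 < n) : 0 < gam n f := by
  have h1 : (0 : ℝ) < n := by exact_mod_cast (by omega : 0 < n)
  have h2 : (0 : ℝ) < (n.choose (n - f) : ℝ) := by
    exact_mod_cast Nat.choose_pos (Nat.sub_le n f)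
  exact one_div_pos.2 (mul_pos h1 h2)

theorem gam_lt_one (hn : 1 < n) : gam n f < 1 := by
  have h1 : (1 : ℝ) < n := by exact_mod_cast hn
  have h2 : (1 : ℝ) ≤ (n.choose (n - f) : ℝ) := by
    exact_mod_cast Nat.choose_pos (Nat.sub_le n f)
  rw [gam, div_lt_one (by positivity)]
  nlinarith

/-- After `numRounds` contractions by `1 - γ`, an initial spread of at most `U - ν` has become at
most `ε`. -/
theorem pow_numRounds_mul_le {ε ν U : ℝ} (hn : 1 < n) (hε : 0 < ε) (hU : ν ≤ U) :
    (1 - gam n f) ^ numRounds n f ε ν U * (U - ν) ≤ ε := by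
  have hg0 := gam_pos (f := f) hn
  have hg1 := gam_lt_one (f := f) hn
  have hpos : 0 < 1 - gam n f := by linarith
  rcases hU.eq_or_lt with rfl | hlt
  · simpa using hε.le
  have hb : 1 < 1 / (1 - gam n f) := by
    rw [lt_div_iff₀ hpos]; linarith
  have hlog : Real.logb (1 / (1 - gam n f)) ((U - ν) / ε) ≤ (numRounds n f ε ν U : ℝ) := by
    have h1 : (⌈Real.logb (1 / (1 - gam n f)) ((U - ν) / ε)⌉ : ℤ) ≤ (numRounds n f ε ν U : ℤ) := by
      have := Int.self_le_toNat (1 + ⌈Real.logb (1 / (1 - gam n f)) ((U - ν) / ε)⌉)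
      rw [numRounds]; omega
    refine (Int.le_ceil _).trans ?_
    exact_mod_cast h1
  rw [Real.logb_le_iff_le_rpow hb (div_pos (sub_pos.2 hlt) hε), Real.rpow_natCast,
    one_div, inv_pow, div_le_iff₀ hε] at hlog
  calc (1 - gam n f) ^ numRounds n f ε ν U * (U - ν)
      ≤ (1 - gam n f) ^ numRounds n f ε ν U *
        (((1 - gam n f) ^ numRounds n f ε ν U)⁻¹ * ε) :=
        mul_le_mul_of_nonneg_left hlog (pow_pos hpos _).le
    _ = ε := by rw [← mul_assoc, mul_inv_cancel₀ (pow_pos hpos _).ne', one_mul]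

end Round

/-! ### The protocol -/

/-- The public claims of a process, which form the content of its messages.  The rounds are
numbered from `0` here, so that slot `r` belongs to round `r + 1` of the algorithm.
`init r` is the state that the process broadcasts in round `r`, `echo q r` and `ready q r` are its
votes of the first and the second phase in the reliable broadcast by `q` in round `r`, and
`report r` is the set of the tuples of round `r` that it had accepted when they first were at least
`n - f`. -/
structure Board (n d R : ℕ) where
  init : Fin R → Option (Pt d)
  echo : Fin n → Fin R → Option (Pt d)
  ready : Fin n → Fin R → Option (Pt d)
  report : Fin R → Option (Finset (Tup n d))

/-- `b ≤ b'` if `b'` repeats all claims of `b`. -/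
structure Board.Le {n d R : ℕ} (b b' : Board n d R) : Prop where
  init {r w} : b.init r = some w → b'.init r = some w
  echo {q r w} : b.echo q r = some w → b'.echo q r = some w
  ready {q r w} : b.ready q r = some w → b'.ready q r = some w
  report {r C} : b.report r = some C → b'.report r = some C

instance (n d R : ℕ) : Preorder (Board n d R) where
  le := Board.Le
  le_refl _ := ⟨id, id, id, id⟩
  le_trans _ _ _ h h' :=
    ⟨h'.init ∘ h.init, h'.echo ∘ h.echo, h'.ready ∘ h.ready, h'.report ∘ h.report⟩

/-- The board without any claim. -/
def Board.empty (n d R : ℕ) : Board n d R :=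
  ⟨fun _ => none, fun _ _ => none, fun _ _ => none, fun _ => none⟩

theorem Board.empty_le {n d R : ℕ} (b : Board n d R) : Board.empty n d R ≤ b :=
  ⟨nofun, nofun, nofun, nofun⟩

/-- The local state of a process: its input, its own board, the last board received from each
process, and the pairs (set obtained, new state) of the completed rounds. -/
structure Local (n d R : ℕ) where
  input : Pt d
  own : Board n d R
  known : Fin n → Board n d R
  hist : List (Finset (Tup n d) × Pt d)

/-- The states of a process at the start and at the end of each completed round. -/
def vals {n d : ℕ} (x : Pt d) (h : List (Finset (Tup n d) × Pt d)) : List (Pt d) :=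
  x :: h.map Prod.snd

open Classical in
/-- The number of processes with property `p`. -/
noncomputable def votes {n : ℕ} (p : Fin n → Prop) : ℕ := (Finset.univ.filter p).card

section Rules

variable {n d R : ℕ} (f : ℕ) (K : Fin n → Board n d R)

open Classical in
/-- The tuples of slot `r` with at least `n - f` `ready` votes on the boards `K`. -/
noncomputable def accepted (r : Fin R) : Finset (Tup n d) :=
  ((Finset.univ : Finset (Fin n × Fin n)).biUnion fun jq =>
    ((K jq.1).ready jq.2 r).toFinset.image fun w => ⟨jq.2, w, r + 1⟩).filter fun τ =>
      n - f ≤ votes fun j => (K j).ready τ.proc r = some τ.pt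

/-- What suffices for a `ready` vote for `w`: `n - f` echoes, or `f + 1` earlier `ready` votes. -/
def ReadyRule (q : Fin n) (r : Fin R) (w : Pt d) : Prop :=
  n - f ≤ votes (fun j => (K j).echo q r = some w) ∨
    f + 1 ≤ votes (fun j => (K j).ready q r = some w)

open Classical in
/-- A value that satisfies `ReadyRule`, if there is one. -/
noncomputable def newReady (q : Fin n) (r : Fin R) : Option (Pt d) :=
  if h : ∃ w, ReadyRule f K q r w then some h.choose else none

open Classical in
/-- The accepted tuples, if they are at least `n - f`. -/
noncomputable def newReport (r : Fin R) : Option (Finset (Tup n d)) :=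
  if n - f ≤ (accepted f K r).card then some (accepted f K r) else none

/-- At least `n - f` processes have reported sets of at least `n - f` tuples all of which are
accepted here. -/
def Witnessed (r : Fin R) : Prop :=
  n - f ≤ votes fun j => ∃ C, (K j).report r = some C ∧ n - f ≤ C.card ∧ C ⊆ accepted f K r

variable (sel : Finset (Tup n d) → Pt d)

open Classical in
/-- The completed rounds after a step: the current round is completed when it is witnessed. -/
noncomputable def newHist (h : List (Finset (Tup n d) × Pt d)) :
    List (Finset (Tup n d) × Pt d) :=
  if hr : ∃ hl : h.length < R, Witnessed f K ⟨h.length, hl⟩ then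
    h ++ [(accepted f K ⟨h.length, hr.1⟩, average f sel (accepted f K ⟨h.length, hr.1⟩))]
  else h

/-- The local computation of a process that knows the boards `K`. -/
noncomputable def advance (s : Local n d R) : Local n d R where
  input := s.input
  -- What the process has claimed before takes precedence over what the rules give now: this is why
  -- it votes for at most one value and its claims persist.
  own :=
    { init := fun r => (vals s.input (newHist f K sel s.hist))[(r : ℕ)]?
      echo := fun q r => s.own.echo q r <|> (K q).init r
      ready := fun q r => s.own.ready q r <|> newReady f K q r
      report := fun r => s.own.report r <|> newReport f K r }
  known := K
  hist := newHist f K sel s.hist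

end Rules

/-- The initial local state of a process with input `x`. -/
def start (n : ℕ) {d : ℕ} (R : ℕ) (x : Pt d) : Local n d R where
  input := x
  own := { Board.empty n d R with init := fun r => (vals (n := n) x [])[(r : ℕ)]? }
  known := fun _ => Board.empty n d R
  hist := []

/-- The known boards after the reception of `o`. -/
def receive {n d R : ℕ} (K : Fin n → Board n d R) (o : Option (Fin n × Board n d R)) :
    Fin n → Board n d R :=
  match o with
  | none => K
  | some (j, m) => Function.update K j m

/-- The protocol with `R` rounds: in each step a process updates its board by means of the boards
that it knows, and sends it to all processes.  This is reducible so that `Protocol.Msg` and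
`Protocol.State` unfold to the types of boards and local states. -/
noncomputable abbrev proto (n d f R : ℕ) (sel : Finset (Tup n d) → Pt d) : Protocol n (Pt d) where
  Msg := Board n d R
  State := Local n d R
  init _ x := start n R x
  step _ s o :=
    let s' := advance f (receive s.known o) sel s
    (s', fun _ => [s'.own])
  decision s := if s.hist.length = R then (vals s.input s.hist)[R]? else none

/-! ### Executions as runs with monotone boards -/

/-- What the non-faulty processes see of an execution, `S i k` being the local state of process `i`
before step `k`: they compute according to the protocol again and again, and the boards known of a
non-faulty process are earlier boards of that process and will catch up with every board of it. -/
structure Run {n d R : ℕ} (f : ℕ) (sel : Finset (Tup n d) → Pt d) (F : Finset (Fin n))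
    (x : Fin n → Pt d) (S : Fin n → ℕ → Local n d R) : Prop where
  init : ∀ i, i ∉ F → S i 0 = start n R (x i)
  step : ∀ i, i ∉ F → ∀ k, S i (k + 1) = S i k ∨
    S i (k + 1) = advance f (S i (k + 1)).known sel (S i k)
  fair : ∀ i, i ∉ F → ∀ k, ∃ k', k ≤ k' ∧
    S i (k' + 1) = advance f (S i (k' + 1)).known sel (S i k')
  sound : ∀ i, i ∉ F → ∀ j, j ∉ F → ∀ k, (S i (k + 1)).known j ≤ (S j k).own
  deliver : ∀ i, i ∉ F → ∀ j, j ∉ F → ∀ k₀, ∀ᶠ k in Filter.atTop,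
    (S j k₀).own ≤ (S i k).known j

section LocalStep

variable {n d f R : ℕ} {sel : Finset (Tup n d) → Pt d} {K : Fin n → Board n d R}

theorem newHist_prefix (h : List (Finset (Tup n d) × Pt d)) : h <+: newHist f K sel h := by
  rw [newHist]
  split
  · exact List.prefix_append _ _
  · exact List.prefix_rfl

theorem getElem?_of_prefix {α : Type*} {l l' : List α} (h : l <+: l') {i : ℕ} {a : α}
    (ha : l[i]? = some a) : l'[i]? = some a := by
  obtain ⟨t, rfl⟩ := h
  rw [List.getElem?_append_left (List.getElem?_eq_some_iff.1 ha).1, ha]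

theorem vals_prefix {x : Pt d} {h h' : List (Finset (Tup n d) × Pt d)} (hp : h <+: h') :
    vals x h <+: vals x h' := by
  rw [vals, vals, List.prefix_cons_inj]
  exact hp.map _

theorem own_le_advance {s : Local n d R}
    (hs : ∀ r : Fin R, s.own.init r = (vals s.input s.hist)[(r : ℕ)]?) :
    s.own ≤ (advance f K sel s).own where
  init {r w} h := by
    rw [hs] at h
    exact getElem?_of_prefix (vals_prefix (newHist_prefix _)) h
  echo h := by simp [advance, h]
  ready h := by simp [advance, h]
  report h := by simp [advance, h]

end LocalStep

/-- In the queue formed by the board `known` received last and the boards in transit, all boards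
from place `p` on, which exists, are at least `b`.  For `p = 0` the board `known` is among them. -/
def Late {α : Type*} [LE α] (b known : α) (chan : List α) (p : ℕ) : Prop :=
  p ≤ chan.length ∧ ∀ m ∈ (known :: chan).drop p, b ≤ m

section Network

variable {n d f R : ℕ} {sel : Finset (Tup n d) → Pt d} {F : Finset (Fin n)} {x : Fin n → Pt d}
  {e : Execution (proto n d f R sel)}

/-- The local state of process `i` before step `k`. -/
def locals (e : Execution (proto n d f R sel)) (i : Fin n) (k : ℕ) : Local n d R :=
  (e.config k).state i

theorem locals_of_ne (he : Admissible _ F x e) {i : Fin n} {k : ℕ}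
    (h : (e.action k).actor ≠ i) : locals e i (k + 1) = locals e i k := by
  rw [locals, (he.step k).2.1, Function.update_of_ne h.symm]
  rfl

theorem locals_of_eq (he : Admissible _ F x e) {i : Fin n} (hi : i ∉ F) {k : ℕ}
    (h : (e.action k).actor = i) : locals e i (k + 1) =
      advance f (receive (locals e i k).known (e.action k).received) sel (locals e i k) := by
  subst h
  have h1 := (he.step k).1 hi
  rw [locals, (he.step k).2.1, Function.update_self]
  exact congrArg Prod.fst h1

theorem sent_eq (he : Admissible _ F x e) {i : Fin n} (hi : i ∉ F) {k : ℕ}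
    (h : (e.action k).actor = i) (j : Fin n) :
    (e.action k).sent j = [(locals e i (k + 1)).own] := by
  subst h
  have h1 := (he.step k).1 hi
  rw [locals, (he.step k).2.1, Function.update_self]
  rw [show (e.action k).newState = _ from congrArg Prod.fst h1,
    show (e.action k).sent = _ from congrArg Prod.snd h1]

theorem locals_step (he : Admissible _ F x e) {i : Fin n} (hi : i ∉ F) (k : ℕ) :
    locals e i (k + 1) = locals e i k ∨ ∃ K, locals e i (k + 1) = advance f K sel (locals e i k) :=
  (ne_or_eq _ _).imp (locals_of_ne he) fun h => ⟨_, locals_of_eq he hi h⟩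

theorem locals_init (he : Admissible _ F x e) {i : Fin n} (hi : i ∉ F) (k : ℕ) (r : Fin R) :
    (locals e i k).own.init r = (vals (locals e i k).input (locals e i k).hist)[(r : ℕ)]? := by
  induction k with
  | zero =>
    rw [locals, he.init_state i hi]
    rfl
  | succ k ih =>
    rcases locals_step he hi k with h | ⟨K, h⟩
    · rw [h, ih]
    · rw [h]; rfl

theorem own_mono (he : Admissible _ F x e) {i : Fin n} (hi : i ∉ F) :
    Monotone fun k => (locals e i k).own := by
  refine monotone_nat_of_le_succ fun k => ?_
  rcases locals_step he hi k with h | ⟨K, h⟩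
  · rw [h]
  · rw [h]
    exact own_le_advance (locals_init he hi k)

/-- The last board received from `j` followed by the boards in transit from `j` is a queue, into
which `j` puts its current board and which moves on at each reception. -/
theorem queue_step (he : Admissible _ F x e) {i j : Fin n} (hi : i ∉ F) (hj : j ∉ F) (k : ℕ) :
    ∃ q add : List (Board n d R),
      (e.config (k + 1)).chan j i = q ++ add ∧
      (∀ m ∈ add, m = (locals e j (k + 1)).own) ∧
      ((e.action k).actor = j → add = [(locals e j (k + 1)).own]) ∧
      ((locals e i (k + 1)).known j :: q = (e.config k).chan j i ∨
        (locals e i (k + 1)).known j :: q = (locals e i k).known j :: (e.config k).chan j i ∧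
          ¬ ((e.action k).actor = i ∧ ∃ m, (e.action k).received = some (j, m))) := by
  obtain ⟨-, -, q, hq, hchan⟩ := he.step k
  refine ⟨q j i, if j = (e.action k).actor then (e.action k).sent i else [], ?_, ?_, ?_, ?_⟩
  · rw [hchan]; split <;> simp
  · intro m hm
    split at hm
    · rename_i h
      rw [sent_eq he hj h.symm] at hm
      simpa using hm
    · simp at hm
  · intro h
    rw [if_pos h.symm, sent_eq he hj h]
  · by_cases ha : (e.action k).actor = i
    · have hl := locals_of_eq he hi ha
      cases hr : (e.action k).received with
      | none =>
        rw [hr] at hq hl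
        right
        have : q = (e.config k).chan := hq
        rw [hl, this]
        exact ⟨rfl, by simp⟩
      | some jm =>
        obtain ⟨j', m⟩ := jm
        rw [hr] at hq hl
        obtain ⟨h1, h2⟩ := hq
        rw [ha] at h1 h2
        by_cases hjj : j = j'
        · subst hjj
          left
          rw [h1, hl]
          simp [advance, receive]
        · right
          rw [hl, h2 j i (by simp [hjj])]
          refine ⟨by simp [advance, receive, hjj], ?_⟩
          rintro ⟨-, m', hm'⟩
          exact hjj (congrArg Prod.fst (Option.some.inj hm')).symm
    · right
      rw [locals_of_ne he ha]
      refine ⟨?_, fun h => ha h.1⟩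
      cases hr : (e.action k).received with
      | none =>
        rw [hr] at hq
        have : q = (e.config k).chan := hq
        rw [this]
      | some jm =>
        obtain ⟨j', m⟩ := jm
        rw [hr] at hq
        rw [hq.2 j i (by simp [Ne.symm ha])]

theorem queue_le (he : Admissible _ F x e) {i j : Fin n} (hi : i ∉ F) (hj : j ∉ F) (k : ℕ) :
    ∀ m ∈ (locals e i k).known j :: (e.config k).chan j i, m ≤ (locals e j k).own := by
  induction k with
  | zero =>
    intro m hm
    rw [he.init_chan, List.mem_singleton, locals, he.init_state i hi] at hm
    rw [hm]
    exact Board.empty_le _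
  | succ k ih =>
    obtain ⟨q, add, hc, hadd, -, hq⟩ := queue_step he hi hj k
    have hmono := own_mono he hj (Nat.le_succ k)
    intro m hm
    rw [hc, ← List.cons_append, List.mem_append] at hm
    rcases hm with hm | hm
    · refine (ih m ?_).trans hmono
      rcases hq with hq | ⟨hq, -⟩
      · rw [hq] at hm
        exact List.mem_cons_of_mem _ hm
      · rwa [hq] at hm
    · rw [hadd m hm]

theorem known_succ_le (he : Admissible _ F x e) {i j : Fin n} (hi : i ∉ F) (hj : j ∉ F) (k : ℕ) :
    (locals e i (k + 1)).known j ≤ (locals e j k).own := by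
  obtain ⟨q, add, -, -, -, hq⟩ := queue_step he hi hj k
  refine queue_le he hi hj k _ ?_
  rcases hq with hq | ⟨hq, -⟩
  · rw [← hq]; simp
  · rw [← hq]; simp

/-- The boards beyond `b` stay in their places in one step, and move on by one place if `i`
receives a board of `j`. -/
theorem late_succ (he : Admissible _ F x e) {i j : Fin n} (hi : i ∉ F) (hj : j ∉ F)
    {b : Board n d R} {k p : ℕ} (hb : b ≤ (locals e j k).own)
    (h : Late b ((locals e i k).known j) ((e.config k).chan j i) p) :
    Late b ((locals e i (k + 1)).known j) ((e.config (k + 1)).chan j i) (p - 1) ∨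
      Late b ((locals e i (k + 1)).known j) ((e.config (k + 1)).chan j i) p ∧
        ¬ ((e.action k).actor = i ∧ ∃ m, (e.action k).received = some (j, m)) := by
  obtain ⟨q, add, hc, hadd, -, hq⟩ := queue_step he hi hj k
  obtain ⟨hlen, hdrop⟩ := h
  have hmono : b ≤ (locals e j (k + 1)).own := hb.trans (own_mono he hj (Nat.le_succ k))
  have hadd' : ∀ m ∈ add, b ≤ m := fun m hm => by rwa [hadd m hm]
  have key : ∀ p', p' ≤ q.length →
      (∀ m ∈ ((locals e i (k + 1)).known j :: q).drop p', b ≤ m) →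
      Late b ((locals e i (k + 1)).known j) ((e.config (k + 1)).chan j i) p' := by
    intro p' hp' hm'
    refine ⟨by rw [hc, List.length_append]; omega, fun m hm => ?_⟩
    rw [hc, ← List.cons_append, List.drop_append, List.mem_append] at hm
    exact hm.elim (hm' m) fun h => hadd' m (List.mem_of_mem_drop h)
  rcases hq with hq | ⟨hq, hno⟩
  · left
    have hl := congrArg List.length hq
    rw [List.length_cons] at hl
    refine key _ (by omega) fun m hm => hdrop m ?_
    rw [hq] at hm
    rcases p with _ | p
    · exact List.mem_cons_of_mem _ hm
    · exact hm
  · right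
    have hl := congrArg List.length hq
    rw [List.length_cons, List.length_cons] at hl
    exact ⟨key _ (by omega) (by rwa [hq]), hno⟩

/-- A board in transit reaches the head of its channel, since the channel moves on again and again
until it does. -/
theorem exists_late_zero (he : Admissible _ F x e) {i j : Fin n} (hi : i ∉ F) (hj : j ∉ F)
    {b : Board n d R} {p k : ℕ} (hb : b ≤ (locals e j k).own)
    (h : Late b ((locals e i k).known j) ((e.config k).chan j i) p) :
    ∃ k', k ≤ k' ∧ Late b ((locals e i k').known j) ((e.config k').chan j i) 0 := by
  induction p generalizing k with
  | zero => exact ⟨k, le_rfl, h⟩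
  | succ p ih =>
    obtain ⟨k₁, hk₁, hrec⟩ := he.fair_receive i hi j k (by
      intro hnil
      have := h.1
      rw [hnil] at this
      simp at this)
    have hstay : ∀ m, (∃ k', k ≤ k' ∧ Late b ((locals e i k').known j)
        ((e.config k').chan j i) p) ∨
        Late b ((locals e i (k + m)).known j) ((e.config (k + m)).chan j i) (p + 1) := by
      intro m
      induction m with
      | zero => exact Or.inr h
      | succ m ihm =>
        refine ihm.elim Or.inl fun hm => ?_
        rcases late_succ he hi hj (hb.trans (own_mono he hj (Nat.le_add_right k m))) hm with h' | h'
        · exact Or.inl ⟨k + m + 1, by omega, h'⟩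
        · exact Or.inr h'.1
    have hp : ∃ k', k ≤ k' ∧ Late b ((locals e i k').known j) ((e.config k').chan j i) p := by
      refine (hstay (k₁ - k)).elim id fun hm => ?_
      rw [Nat.add_sub_cancel' hk₁] at hm
      rcases late_succ he hi hj (hb.trans (own_mono he hj hk₁)) hm with h' | h'
      · exact ⟨k₁ + 1, by omega, h'⟩
      · exact absurd hrec h'.2
    obtain ⟨k₂, hk₂, h₂⟩ := hp
    obtain ⟨k₃, hk₃, h₃⟩ := ih (hb.trans (own_mono he hj hk₂)) h₂
    exact ⟨k₃, hk₂.trans hk₃, h₃⟩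

theorem eventually_le_known (he : Admissible _ F x e) {i j : Fin n} (hi : i ∉ F) (hj : j ∉ F)
    (k₀ : ℕ) : ∀ᶠ k in Filter.atTop, (locals e j k₀).own ≤ (locals e i k).known j := by
  obtain ⟨k₁, hk₁, ha⟩ := he.fair_step j hj k₀
  have hmono : (locals e j k₀).own ≤ (locals e j (k₁ + 1)).own := own_mono he hj (by omega)
  obtain ⟨q, add, hc, -, hadd, -⟩ := queue_step he hi hj k₁
  rw [hadd ha] at hc
  obtain ⟨k₂, hk₂, h₂⟩ := exists_late_zero he hi hj (p := q.length + 1) hmono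
    ⟨by simp [hc], by simpa [hc] using hmono⟩
  have hall : ∀ k, k₂ ≤ k → Late (locals e j k₀).own ((locals e i k).known j)
      ((e.config k).chan j i) 0 := by
    intro k hk
    induction k, hk using Nat.le_induction with
    | base => exact h₂
    | succ k hk ih =>
      exact (late_succ he hi hj (own_mono he hj (by omega)) ih).elim id And.left
  exact Filter.eventually_atTop.2 ⟨k₂, fun k hk => (hall k hk).2 _ (by simp)⟩

theorem Admissible.run (he : Admissible _ F x e) : Run f sel F x (locals e) := by
  have hadv : ∀ i, i ∉ F → ∀ k, (e.action k).actor = i →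
      locals e i (k + 1) = advance f (locals e i (k + 1)).known sel (locals e i k) := by
    intro i hi k ha
    have h := locals_of_eq he hi ha
    have hK := congrArg Local.known h
    rw [hK]
    exact h
  exact
    { init := he.init_state
      step := fun i hi k => (ne_or_eq _ _).imp (locals_of_ne he) (hadv i hi k)
      fair := fun i hi k => by
        obtain ⟨k', hk', ha⟩ := he.fair_step i hi k
        exact ⟨k', hk', hadv i hi k' ha⟩
      sound := fun i hi j hj k => known_succ_le he hi hj k
      deliver := fun i hi j hj k₀ => eventually_le_known he hi hj k₀ }

end Network

/-! ### Quorums -/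

section Quorums

variable {n f : ℕ} {F : Finset (Fin n)} {p q : Fin n → Prop}

/-- At least `n - f` processes are faulty or have property `p`.  A faulty process counts whatever it
claims, so that `n - f` votes received give a `Support` by the claims of the non-faulty
processes. -/
def Support (f : ℕ) (F : Finset (Fin n)) (p : Fin n → Prop) : Prop :=
  n - f ≤ votes fun j => j ∈ F ∨ p j

theorem votes_mono (h : ∀ j, p j → q j) : votes p ≤ votes q := by
  classical
  exact Finset.card_le_card (Finset.monotone_filter_right _ fun j _ => h j)

theorem Support.mono (hp : Support f F p) (h : ∀ j, j ∉ F → p j → q j) : Support f F q :=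
  hp.trans (votes_mono fun j hj => (em (j ∈ F)).imp_right fun hjF =>
    h j hjF (hj.resolve_left hjF))

theorem support_of_votes (hp : n - f ≤ votes p) (h : ∀ j, j ∉ F → p j → q j) : Support f F q :=
  hp.trans (votes_mono fun j hj => (em (j ∈ F)).imp_right fun hjF => h j hjF hj)

/-- Two quorums share a non-faulty process. -/
theorem Support.exists_and (hF : F.card ≤ f) (hn : 3 * f + 1 ≤ n) (hp : Support f F p)
    (hq : Support f F q) : ∃ j, j ∉ F ∧ p j ∧ q j := by
  classical
  by_contra! hc
  rw [Support, votes] at hp hq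
  have h1 := Finset.card_union_add_card_inter
    (Finset.univ.filter fun j => j ∈ F ∨ p j) (Finset.univ.filter fun j => j ∈ F ∨ q j)
  have h2 := Finset.card_le_univ
    ((Finset.univ.filter fun j => j ∈ F ∨ p j) ∪ (Finset.univ.filter fun j => j ∈ F ∨ q j))
  have h3 : ((Finset.univ.filter fun j => j ∈ F ∨ p j) ∩
      (Finset.univ.filter fun j => j ∈ F ∨ q j)).card ≤ F.card := by
    refine Finset.card_le_card fun j hj => ?_
    simp only [Finset.mem_inter, Finset.mem_filter, Finset.mem_univ, true_and] at hj
    by_contra hjF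
    exact hc j hjF (hj.1.resolve_left hjF) (hj.2.resolve_left hjF)
  rw [Fintype.card_fin] at h2
  -- `convert` reconciles the decidability instances hidden in `votes`
  have hp' : n - f ≤ (Finset.univ.filter fun j => j ∈ F ∨ p j).card := by convert hp
  have hq' : n - f ≤ (Finset.univ.filter fun j => j ∈ F ∨ q j).card := by convert hq
  omega

theorem Support.exists (hF : F.card ≤ f) (hn : 3 * f + 1 ≤ n) (hp : Support f F p) :
    ∃ j, j ∉ F ∧ p j :=
  let ⟨j, hj, hpj, _⟩ := hp.exists_and hF hn hp
  ⟨j, hj, hpj⟩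

theorem exists_of_votes (hF : F.card ≤ f) (hp : f + 1 ≤ votes p) : ∃ j, j ∉ F ∧ p j := by
  classical
  by_contra! hc
  have h : votes p ≤ F.card := Finset.card_le_card fun j hj => by
    by_contra hjF
    exact hc j hjF (Finset.mem_filter.1 hj).2
  omega

theorem Support.votes (hF : F.card ≤ f) (hn : 3 * f + 1 ≤ n) (hp : Support f F p) :
    f + 1 ≤ votes fun j => j ∉ F ∧ p j := by
  classical
  have h : BVC.votes (fun j => j ∈ F ∨ p j) ≤ F.card + BVC.votes fun j => j ∉ F ∧ p j := by
    refine le_trans (Finset.card_le_card fun j hj => ?_) (Finset.card_union_le _ _)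
    simp only [Finset.mem_filter, Finset.mem_union, Finset.mem_univ, true_and] at hj ⊢
    tauto
  rw [Support] at hp
  omega

theorem exists_notMem_of_card_lt (hF : F.card < n) : ∃ i, i ∉ F := by
  by_contra! h
  have h1 := Finset.card_le_card fun i (_ : i ∈ Finset.univ) => h i
  rw [Finset.card_univ, Fintype.card_fin] at h1
  omega

theorem votes_of_forall (hF : F.card ≤ f) (h : ∀ j, j ∉ F → p j) : n - f ≤ votes p := by
  classical
  have h1 : Fᶜ.card ≤ votes p := Finset.card_le_card fun j hj => by
    simpa using h j (Finset.mem_compl.1 hj)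
  rw [Finset.card_compl, Fintype.card_fin] at h1
  omega

end Quorums

theorem mem_accepted {n d f R : ℕ} (hf : f < n) {K : Fin n → Board n d R} {r : Fin R}
    {τ : Tup n d} : τ ∈ accepted f K r ↔
      τ.round = r + 1 ∧ n - f ≤ votes fun j => (K j).ready τ.proc r = some τ.pt := by
  classical
  rw [accepted, Finset.mem_filter]
  refine and_congr_left fun h => ?_
  obtain ⟨j, -, hj⟩ := exists_of_votes (F := (∅ : Finset (Fin n))) (f := 0) (by simp)
    (show 0 + 1 ≤ votes fun j => (K j).ready τ.proc r = some τ.pt by omega)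
  simp only [Finset.mem_biUnion, Finset.mem_image, Option.mem_toFinset]
  constructor
  · rintro ⟨-, -, w, -, rfl⟩
    rfl
  · intro hr
    exact ⟨(j, τ.proc), Finset.mem_univ _, τ.pt, hj, by rw [← hr]⟩

theorem newReady_eq_some {n d f R : ℕ} {K : Fin n → Board n d R} {q : Fin n} {r : Fin R}
    {w : Pt d} (h : newReady f K q r = some w) : ReadyRule f K q r w := by
  rw [newReady] at h
  split at h
  · rename_i hex
    rw [← Option.some.inj h]
    exact hex.choose_spec
  · simp at h

theorem exists_newReady {n d f R : ℕ} {K : Fin n → Board n d R} {q : Fin n} {r : Fin R}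
    {w : Pt d} (h : ReadyRule f K q r w) : ∃ w', newReady f K q r = some w' :=
  ⟨_, dif_pos ⟨w, h⟩⟩

theorem exists_orElse {α : Type*} (a : Option α) {b : Option α} (h : ∃ w, b = some w) :
    ∃ w, (a <|> b) = some w := by
  obtain ⟨w, rfl⟩ := h
  cases a with
  | none => exact ⟨w, rfl⟩
  | some v => exact ⟨v, rfl⟩

theorem orElse_eq_some {α : Type*} {a b : Option α} {w : α} (h : (a <|> b) = some w) :
    a = some w ∨ b = some w := by
  cases a with
  | none => exact Or.inr h
  | some v => exact Or.inl h

/-! ### Safety -/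

namespace Run

variable {n d f R : ℕ} {sel : Finset (Tup n d) → Pt d} {F : Finset (Fin n)} {x : Fin n → Pt d}
  {S : Fin n → ℕ → Local n d R}

theorem input_eq (h : Run f sel F x S) {i : Fin n} (hi : i ∉ F) (k : ℕ) :
    (S i k).input = x i := by
  induction k with
  | zero => rw [h.init i hi]; rfl
  | succ k ih =>
    rcases h.step i hi k with hs | hs
    · rw [hs, ih]
    · rw [hs, ← ih]; rfl

theorem own_init (h : Run f sel F x S) {i : Fin n} (hi : i ∉ F) (k : ℕ) (r : Fin R) :
    (S i k).own.init r = (vals (x i) (S i k).hist)[(r : ℕ)]? := by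
  rw [← h.input_eq hi k]
  induction k with
  | zero => rw [h.init i hi]; rfl
  | succ k ih =>
    rcases h.step i hi k with hs | hs
    · rw [hs, ih]
    · rw [hs]; rfl

theorem own_mono (h : Run f sel F x S) {i : Fin n} (hi : i ∉ F) :
    Monotone fun k => (S i k).own := by
  refine monotone_nat_of_le_succ fun k => ?_
  rcases h.step i hi k with hs | hs
  · rw [hs]
  · rw [hs]
    refine own_le_advance fun r => ?_
    rw [h.own_init hi, h.input_eq hi]

theorem hist_step (h : Run f sel F x S) {i : Fin n} (hi : i ∉ F) (k : ℕ) :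
    (S i (k + 1)).hist = (S i k).hist ∨
      ∃ hl : (S i k).hist.length < R, Witnessed f (S i (k + 1)).known ⟨_, hl⟩ ∧
        (S i (k + 1)).hist = (S i k).hist ++
          [(accepted f (S i (k + 1)).known ⟨_, hl⟩,
            average f sel (accepted f (S i (k + 1)).known ⟨_, hl⟩))] := by
  rcases h.step i hi k with hs | hs
  · exact Or.inl (by rw [hs])
  · have hh : (S i (k + 1)).hist = newHist f (S i (k + 1)).known sel (S i k).hist :=
      congrArg Local.hist hs
    rw [newHist] at hh
    split at hh
    · rename_i hr
      exact Or.inr ⟨hr.1, hr.2, hh⟩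
    · exact Or.inl hh

theorem hist_prefix (h : Run f sel F x S) {i : Fin n} (hi : i ∉ F) {k k' : ℕ} (hk : k ≤ k') :
    (S i k).hist <+: (S i k').hist := by
  induction k', hk using Nat.le_induction with
  | base => exact List.prefix_rfl
  | succ k' _ ih =>
    refine ih.trans ?_
    rcases h.hist_step hi k' with hs | ⟨_, _, hs⟩
    · rw [hs]
    · rw [hs]; exact List.prefix_append _ _

theorem hist_length_le (h : Run f sel F x S) {i : Fin n} (hi : i ∉ F) (k : ℕ) :
    (S i k).hist.length ≤ R := by
  induction k with
  | zero => rw [h.init i hi]; exact Nat.zero_le _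
  | succ k ih =>
    rcases h.hist_step hi k with hs | ⟨hl, _, hs⟩
    · rwa [hs]
    · rw [hs, List.length_append, List.length_singleton]
      exact hl

/-- Echoes for a non-faulty process are for the state that it has broadcast. -/
theorem echo_sound (h : Run f sel F x S) {i : Fin n} (hi : i ∉ F) {q : Fin n} (hq : q ∉ F)
    {r : Fin R} {w : Pt d} (k : ℕ) (he : (S i k).own.echo q r = some w) :
    (S q k).own.init r = some w := by
  induction k with
  | zero =>
    rw [h.init i hi] at he
    simp [start, Board.empty] at he
  | succ k ih =>
    refine (h.own_mono hq (Nat.le_succ k)).init ?_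
    rcases h.step i hi k with hs | hs
    · rw [hs] at he
      exact ih he
    · rw [hs] at he
      exact (orElse_eq_some he).elim ih (h.sound i hi q hq k).init

/-- A `ready` vote goes back to a quorum of echoes. -/
theorem ready_sound (h : Run f sel F x S) (hF : F.card ≤ f) {q : Fin n} {r : Fin R} {w : Pt d}
    (k : ℕ) : ∀ i, i ∉ F → (S i k).own.ready q r = some w →
      Support f F fun j => (S j k).own.echo q r = some w := by
  induction k with
  | zero =>
    intro i hi hr
    rw [h.init i hi] at hr
    simp [start, Board.empty] at hr
  | succ k ih =>
    intro i hi hr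
    have hold : ∀ j, j ∉ F → (S j k).own.ready q r = some w →
        Support f F fun j => (S j (k + 1)).own.echo q r = some w := fun j hj hjr =>
      (ih j hj hjr).mono fun a ha => (h.own_mono ha (Nat.le_succ k)).echo
    rcases h.step i hi k with hs | hs
    · rw [hs] at hr
      exact hold i hi hr
    · rw [hs] at hr
      rcases orElse_eq_some hr with hr | hr
      · exact hold i hi hr
      · rcases newReady_eq_some hr with hv | hv
        · exact support_of_votes hv fun j hj hje =>
            (h.own_mono hj (Nat.le_succ k)).echo ((h.sound i hi j hj k).echo hje)
        · obtain ⟨j, hj, hjr⟩ := exists_of_votes hF hv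
          exact hold j hj ((h.sound i hi j hj k).ready hjr)

theorem ready_unique (h : Run f sel F x S) (hF : F.card ≤ f) (hn : 3 * f + 1 ≤ n)
    {i j q : Fin n} (hi : i ∉ F) (hj : j ∉ F) {r : Fin R} {w w' : Pt d} {k k' : ℕ}
    (hw : (S i k).own.ready q r = some w) (hw' : (S j k').own.ready q r = some w') : w = w' := by
  have h1 := (h.own_mono hi (le_max_left k k')).ready hw
  have h2 := (h.own_mono hj (le_max_right k k')).ready hw'
  obtain ⟨a, -, ha, ha'⟩ := (h.ready_sound hF _ i hi h1).exists_and hF hn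
    (h.ready_sound hF _ j hj h2)
  exact Option.some.inj (ha.symm.trans ha')

theorem ready_correct (h : Run f sel F x S) (hF : F.card ≤ f) (hn : 3 * f + 1 ≤ n)
    {i q : Fin n} (hi : i ∉ F) (hq : q ∉ F) {r : Fin R} {w : Pt d} {k : ℕ}
    (hw : (S i k).own.ready q r = some w) : (S q k).own.init r = some w := by
  obtain ⟨a, ha, hae⟩ := (h.ready_sound hF _ i hi hw).exists hF hn
  exact h.echo_sound ha hq k hae

/-- All tuples of `C` belong to slot `r` and have a quorum of `ready` votes at time `k`. -/
def Vetted (f : ℕ) (F : Finset (Fin n)) (S : Fin n → ℕ → Local n d R) (k : ℕ) (r : Fin R)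
    (C : Finset (Tup n d)) : Prop :=
  ∀ τ ∈ C, τ.round = r + 1 ∧
    Support f F fun j => (S j k).own.ready τ.proc r = some τ.pt

theorem Vetted.mono (h : Run f sel F x S) {k k' : ℕ} (hk : k ≤ k') {r : Fin R}
    {C : Finset (Tup n d)} (hC : Vetted f F S k r C) : Vetted f F S k' r C := fun τ hτ =>
  ⟨(hC τ hτ).1, (hC τ hτ).2.mono fun _ hj => (h.own_mono hj hk).ready⟩

theorem vetted_accepted (h : Run f sel F x S) (hf : f < n) {i : Fin n} (hi : i ∉ F) (k : ℕ)
    (r : Fin R) : Vetted f F S k r (accepted f (S i (k + 1)).known r) := fun τ hτ => by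
  obtain ⟨h1, h2⟩ := (mem_accepted hf).1 hτ
  exact ⟨h1, support_of_votes h2 fun j hj => (h.sound i hi j hj k).ready⟩

theorem report_sound (h : Run f sel F x S) (hf : f < n) {i : Fin n} (hi : i ∉ F) {r : Fin R}
    {C : Finset (Tup n d)} (k : ℕ) (hr : (S i k).own.report r = some C) :
    n - f ≤ C.card ∧ Vetted f F S k r C := by
  induction k with
  | zero =>
    rw [h.init i hi] at hr
    simp [start, Board.empty] at hr
  | succ k ih =>
    have hold : (S i k).own.report r = some C → n - f ≤ C.card ∧ Vetted f F S (k + 1) r C :=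
      fun hr => (ih hr).imp_right (Vetted.mono h (Nat.le_succ k))
    rcases h.step i hi k with hs | hs
    · rw [hs] at hr
      exact hold hr
    · rw [hs] at hr
      rcases orElse_eq_some hr with hr | hr
      · exact hold hr
      · rw [newReport] at hr
        split at hr
        · rename_i hc
          rw [← Option.some.inj hr]
          exact ⟨hc, (vetted_accepted h hf hi k r).mono h (Nat.le_succ k)⟩
        · simp at hr

/-- What is known of the pair `p` recorded for slot `r`: its tuples are vetted, a quorum of
processes has reported subsets of them, and the new state is their average. -/
def Completed (f : ℕ) (sel : Finset (Tup n d) → Pt d) (F : Finset (Fin n))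
    (S : Fin n → ℕ → Local n d R) (k : ℕ) (r : Fin R) (p : Finset (Tup n d) × Pt d) : Prop :=
  p.2 = average f sel p.1 ∧ Vetted f F S k r p.1 ∧
    Support f F fun j => ∃ C, (S j k).own.report r = some C ∧ n - f ≤ C.card ∧ C ⊆ p.1

theorem hist_sound (h : Run f sel F x S) (hf : f < n) {i : Fin n} (hi : i ∉ F) {r : Fin R}
    {p : Finset (Tup n d) × Pt d} (k : ℕ) (hp : (S i k).hist[(r : ℕ)]? = some p) :
    Completed f sel F S k r p := by
  induction k with
  | zero =>
    rw [h.init i hi] at hp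
    simp [start] at hp
  | succ k ih =>
    have hold : (S i k).hist[(r : ℕ)]? = some p → Completed f sel F S (k + 1) r p := fun hp =>
      let ⟨h1, h2, h3⟩ := ih hp
      ⟨h1, h2.mono h (Nat.le_succ k), h3.mono fun j hj ⟨C, hC, hC'⟩ =>
        ⟨C, (h.own_mono hj (Nat.le_succ k)).report hC, hC'⟩⟩
    rcases h.hist_step hi k with hs | ⟨hl, hw, hs⟩
    · rw [hs] at hp
      exact hold hp
    · rw [hs] at hp
      rcases lt_trichotomy (r : ℕ) (S i k).hist.length with hlt | heq | hgt
      · rw [List.getElem?_append_left hlt] at hp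
        exact hold hp
      · have hr : r = ⟨_, hl⟩ := Fin.ext heq
        rw [heq, List.getElem?_concat_length] at hp
        rw [← Option.some.inj hp, hr]
        refine ⟨rfl, (vetted_accepted h hf hi k _).mono h (Nat.le_succ k), ?_⟩
        exact support_of_votes hw fun j hj ⟨C, hC, hC'⟩ =>
          ⟨C, (h.own_mono hj (Nat.le_succ k)).report ((h.sound i hi j hj k).report hC), hC'⟩
      · rw [List.getElem?_eq_none (by simp; omega)] at hp
        simp at hp

/-! ### Liveness -/

/-- A stable property that each late step of a non-faulty process establishes holds eventually. -/
theorem eventually_of_step (h : Run f sel F x S) {i : Fin n} (hi : i ∉ F) {Q : ℕ → Prop}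
    (hQ : ∀ k, Q k → Q (k + 1))
    (hstep : ∀ᶠ k in Filter.atTop,
      S i (k + 1) = advance f (S i (k + 1)).known sel (S i k) → Q (k + 1)) :
    ∀ᶠ k in Filter.atTop, Q k := by
  obtain ⟨k₀, hk₀⟩ := Filter.eventually_atTop.1 hstep
  obtain ⟨k₁, hk₁, hs⟩ := h.fair i hi k₀
  refine Filter.eventually_atTop.2 ⟨k₁ + 1, fun k hk => ?_⟩
  induction k, hk using Nat.le_induction with
  | base => exact hk₀ k₁ hk₁ hs
  | succ k _ ih => exact hQ k ih

/-- What a non-faulty process claims at some time, all non-faulty processes eventually know. -/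
theorem eventually_known (h : Run f sel F x S) {P : Fin n → Board n d R → Prop}
    (hP : ∀ j b b', b ≤ b' → P j b → P j b') {J : Fin n → Prop}
    (hev : ∀ j, j ∉ F → J j → ∃ k, P j (S j k).own) {i : Fin n} (hi : i ∉ F) :
    ∀ᶠ k in Filter.atTop, ∀ j, j ∉ F → J j → P j ((S i (k + 1)).known j) := by
  refine Filter.eventually_all.2 fun j => ?_
  by_cases hj : j ∉ F ∧ J j
  · obtain ⟨k₀, hk₀⟩ := hev j hj.1 hj.2
    filter_upwards [(Filter.tendsto_add_atTop_nat 1).eventually (h.deliver i hi j hj.1 k₀)]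
      with k hk _ _
    exact hP j _ _ hk hk₀
  · exact Filter.Eventually.of_forall fun k h1 h2 => absurd ⟨h1, h2⟩ hj

/-- A quorum of `ready` votes for `w` contains `f + 1` votes of non-faulty processes.  These make
all non-faulty processes vote `ready` for `w`, and then accept it, even if `q` is faulty. -/
theorem eventually_accepted (h : Run f sel F x S) (hF : F.card ≤ f) (hn : 3 * f + 1 ≤ n)
    {q : Fin n} {r : Fin R} {w : Pt d} {k₀ : ℕ}
    (hw : Support f F fun j => (S j k₀).own.ready q r = some w) {i : Fin n} (hi : i ∉ F) :
    ∀ᶠ k in Filter.atTop, (⟨q, w, r + 1⟩ : Tup n d) ∈ accepted f (S i (k + 1)).known r := by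
  have hready : ∀ a, a ∉ F → ∀ᶠ k in Filter.atTop, (S a k).own.ready q r = some w := by
    intro a ha
    refine h.eventually_of_step ha (fun k => (h.own_mono ha (Nat.le_succ k)).ready) ?_
    filter_upwards [h.eventually_known (P := fun _ b => b.ready q r = some w)
      (fun _ _ _ hle => hle.ready) (J := fun j => (S j k₀).own.ready q r = some w)
      (fun j _ hj => ⟨k₀, hj⟩) ha] with k hk hs
    have hrule : ReadyRule f (S a (k + 1)).known q r w := Or.inr <|
      (hw.votes hF hn).trans (votes_mono fun j hj => hk j hj.1 hj.2)
    obtain ⟨w', hw'⟩ := exists_orElse ((S a k).own.ready q r) (exists_newReady hrule)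
    have hown : (S a (k + 1)).own.ready q r = some w' := by rw [hs]; exact hw'
    obtain ⟨j, hj, hjw⟩ := hw.exists hF hn
    rw [hown, h.ready_unique hF hn ha hj hown hjw]
  filter_upwards [h.eventually_known (P := fun _ b => b.ready q r = some w)
    (fun _ _ _ hle => hle.ready) (J := fun _ => True)
    (fun j hj _ => (hready j hj).exists) hi] with k hk
  exact (mem_accepted (by omega)).2 ⟨rfl, votes_of_forall hF fun j hj => hk j hj trivial⟩

/-- The broadcast of a non-faulty `q` is eventually accepted: all non-faulty processes echo its
state, and then vote `ready` for it. -/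
theorem eventually_accepted_of_init (h : Run f sel F x S) (hF : F.card ≤ f) (hn : 3 * f + 1 ≤ n)
    {q : Fin n} (hq : q ∉ F) {r : Fin R} {w : Pt d} {k₀ : ℕ}
    (hw : (S q k₀).own.init r = some w) {i : Fin n} (hi : i ∉ F) :
    ∀ᶠ k in Filter.atTop, (⟨q, w, r + 1⟩ : Tup n d) ∈ accepted f (S i (k + 1)).known r := by
  have hval : ∀ k w', (S q k).own.init r = some w' → w' = w := fun k w' hw' => by
    have h1 := (h.own_mono hq (le_max_left k k₀)).init hw'
    have h2 := (h.own_mono hq (le_max_right k k₀)).init hw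
    exact Option.some.inj (h1.symm.trans h2)
  have hecho : ∀ a, a ∉ F → ∀ᶠ k in Filter.atTop, (S a k).own.echo q r = some w := by
    intro a ha
    refine h.eventually_of_step ha (fun k => (h.own_mono ha (Nat.le_succ k)).echo) ?_
    filter_upwards [h.eventually_known (P := fun _ b => b.init r = some w)
      (fun _ _ _ hle => hle.init) (J := fun j => j = q)
      (fun j _ hj => ⟨k₀, by rw [hj]; exact hw⟩) ha] with k hk hs
    obtain ⟨w', hw'⟩ := exists_orElse ((S a k).own.echo q r) ⟨w, hk q hq rfl⟩
    have hown : (S a (k + 1)).own.echo q r = some w' := by rw [hs]; exact hw'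
    rw [hown, hval _ _ (h.echo_sound ha hq _ hown)]
  have hready : ∀ a, a ∉ F → ∀ᶠ k in Filter.atTop, (S a k).own.ready q r = some w := by
    intro a ha
    refine h.eventually_of_step ha (fun k => (h.own_mono ha (Nat.le_succ k)).ready) ?_
    filter_upwards [h.eventually_known (P := fun _ b => b.echo q r = some w)
      (fun _ _ _ hle => hle.echo) (J := fun _ => True)
      (fun j hj _ => (hecho j hj).exists) ha] with k hk hs
    have hrule : ReadyRule f (S a (k + 1)).known q r w := Or.inl <|
      votes_of_forall hF fun j hj => hk j hj trivial
    obtain ⟨w', hw'⟩ := exists_orElse ((S a k).own.ready q r) (exists_newReady hrule)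
    have hown : (S a (k + 1)).own.ready q r = some w' := by rw [hs]; exact hw'
    rw [hown, hval _ _ (h.ready_correct hF hn ha hq hown)]
  have hall : ∀ᶠ k in Filter.atTop, ∀ a, a ∉ F → (S a k).own.ready q r = some w :=
    Filter.eventually_all.2 fun a => by
      by_cases ha : a ∈ F
      · exact Filter.Eventually.of_forall fun k hk => absurd ha hk
      · exact (hready a ha).mono fun k hk _ => hk
  obtain ⟨k₁, hk₁⟩ := hall.exists
  exact h.eventually_accepted hF hn (votes_of_forall hF fun j hj => Or.inr (hk₁ j hj)) hi

/-- Once all non-faulty processes have started round `r`, every non-faulty process eventually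
reports the tuples of that round. -/
theorem eventually_report (h : Run f sel F x S) (hF : F.card ≤ f) (hn : 3 * f + 1 ≤ n)
    {r : Fin R} (hinit : ∀ q, q ∉ F → ∃ k w, (S q k).own.init r = some w)
    {i : Fin n} (hi : i ∉ F) : ∃ k C, (S i k).own.report r = some C := by
  classical
  choose! k₀ w hw using hinit
  have hacc : ∀ᶠ k in Filter.atTop, ∀ q, q ∉ F →
      (⟨q, w q, r + 1⟩ : Tup n d) ∈ accepted f (S i (k + 1)).known r :=
    Filter.eventually_all.2 fun q => by
      by_cases hq : q ∈ F
      · exact Filter.Eventually.of_forall fun k hk => absurd hq hk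
      · exact (h.eventually_accepted_of_init hF hn hq (hw q hq) hi).mono fun k hk _ => hk
  refine (h.eventually_of_step hi (Q := fun k => ∃ C, (S i k).own.report r = some C)
    (fun k ⟨C, hC⟩ => ⟨C, (h.own_mono hi (Nat.le_succ k)).report hC⟩) ?_).exists
  filter_upwards [hacc] with k hk hs
  have hcard : n - f ≤ (accepted f (S i (k + 1)).known r).card := by
    have h1 : Fᶜ.card ≤ (accepted f (S i (k + 1)).known r).card :=
      Finset.card_le_card_of_injOn (fun q => (⟨q, w q, r + 1⟩ : Tup n d))
        (fun q hq => hk q (by simpa using hq)) fun q _ q' _ hqq => congrArg Tup.proc hqq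
    rw [Finset.card_compl, Fintype.card_fin] at h1
    omega
  have hnew : newReport f (S i (k + 1)).known r = some (accepted f (S i (k + 1)).known r) :=
    if_pos hcard
  obtain ⟨C, hC⟩ := exists_orElse ((S i k).own.report r) ⟨_, hnew⟩
  exact ⟨C, by rw [hs]; exact hC⟩

/-- Once all non-faulty processes have started a round, all of their reports are eventually known
and their tuples accepted, so that every non-faulty process completes the round. -/
theorem eventually_completes (h : Run f sel F x S) (hF : F.card ≤ f) (hn : 3 * f + 1 ≤ n)
    {r : Fin R} (hlen : ∀ q, q ∉ F → ∀ᶠ k in Filter.atTop, (r : ℕ) ≤ (S q k).hist.length)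
    {i : Fin n} (hi : i ∉ F) : ∀ᶠ k in Filter.atTop, (r : ℕ) + 1 ≤ (S i k).hist.length := by
  have hinit : ∀ q, q ∉ F → ∃ k w, (S q k).own.init r = some w := fun q hq => by
    obtain ⟨k, hk⟩ := (hlen q hq).exists
    refine ⟨k, (vals (x q) (S q k).hist)[(r : ℕ)]'(by simp [vals]; omega), ?_⟩
    rw [h.own_init hq]
    exact List.getElem?_eq_getElem _
  have hrep : ∀ j, j ∉ F → ∃ k C, (S j k).own.report r = some C := fun j hj =>
    h.eventually_report hF hn hinit hj
  choose! k₀ C hC using hrep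
  have hknown := h.eventually_known (P := fun j b => b.report r = some (C j))
    (fun _ _ _ hle => hle.report) (J := fun _ => True) (fun j hj _ => ⟨k₀ j, hC j hj⟩) hi
  have hacc : ∀ᶠ k in Filter.atTop, ∀ j, j ∉ F → C j ⊆ accepted f (S i (k + 1)).known r := by
    refine Filter.eventually_all.2 fun j => ?_
    by_cases hj : j ∈ F
    · exact Filter.Eventually.of_forall fun k hk => absurd hj hk
    · have hτ : ∀ τ ∈ C j, ∀ᶠ k in Filter.atTop, τ ∈ accepted f (S i (k + 1)).known r := by
        intro τ hτ
        obtain ⟨hround, hsup⟩ := (h.report_sound (by omega) hj _ (hC j hj)).2 τ hτ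
        have h1 := h.eventually_accepted hF hn hsup hi
        rwa [← hround] at h1
      exact ((Filter.eventually_all_finset (C j)).2 hτ).mono fun k hk _ => hk
  refine h.eventually_of_step hi
    (fun k hk => hk.trans (h.hist_prefix hi (Nat.le_succ k)).length_le) ?_
  filter_upwards [hknown, hacc, hlen i hi] with k hk1 hk2 hk3 hs
  rcases hk3.lt_or_eq with hlt | heq
  · exact (Nat.succ_le_of_lt hlt).trans (h.hist_prefix hi (Nat.le_succ k)).length_le
  have hwit : Witnessed f (S i (k + 1)).known r := votes_of_forall hF fun j hj =>
    ⟨C j, hk1 j hj trivial, (h.report_sound (by omega) hj _ (hC j hj)).1, hk2 j hj⟩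
  have hex : ∃ hl : (S i k).hist.length < R,
      Witnessed f (S i (k + 1)).known ⟨(S i k).hist.length, hl⟩ := by
    refine ⟨heq ▸ r.2, ?_⟩
    convert hwit
    exact heq.symm
  have hh : (S i (k + 1)).hist = newHist f (S i (k + 1)).known sel (S i k).hist :=
    congrArg Local.hist hs
  rw [hh, newHist, dif_pos hex, List.length_append, List.length_singleton, heq]

theorem eventually_length (h : Run f sel F x S) (hF : F.card ≤ f) (hn : 3 * f + 1 ≤ n)
    {t : ℕ} (ht : t ≤ R) : ∀ i, i ∉ F → ∀ᶠ k in Filter.atTop, t ≤ (S i k).hist.length := by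
  induction t with
  | zero => exact fun _ _ => Filter.Eventually.of_forall fun _ => Nat.zero_le _
  | succ t ih => exact fun i hi => h.eventually_completes hF hn (r := ⟨t, ht⟩) (ih (by omega)) hi

end Run

/-! ### The rounds of an execution -/

theorem Run.exists_final {n d f R : ℕ} {sel : Finset (Tup n d) → Pt d} {F : Finset (Fin n)}
    {x : Fin n → Pt d} {S : Fin n → ℕ → Local n d R} (h : Run f sel F x S) (hF : F.card ≤ f)
    (hn : 3 * f + 1 ≤ n) : ∃ (k₀ : ℕ) (H : Fin n → List (Finset (Tup n d) × Pt d)), ∀ i, i ∉ F →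
      (H i).length = R ∧ (S i k₀).hist = H i ∧ ∀ k, (S i k).hist <+: H i := by
  have hall : ∀ᶠ k in Filter.atTop, ∀ i, i ∉ F → R ≤ (S i k).hist.length :=
    Filter.eventually_all.2 fun i => by
      by_cases hi : i ∈ F
      · exact Filter.Eventually.of_forall fun k hk => absurd hi hk
      · exact (h.eventually_length hF hn le_rfl i hi).mono fun k hk _ => hk
  obtain ⟨k₀, hk₀⟩ := hall.exists
  refine ⟨k₀, fun i => (S i k₀).hist, fun i hi =>
    ⟨(h.hist_length_le hi _).antisymm (hk₀ i hi), rfl, fun k => ?_⟩⟩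
  rcases le_total k k₀ with hk | hk
  · exact h.hist_prefix hi hk
  · have hp := h.hist_prefix hi hk
    exact (hp.eq_of_length_le ((h.hist_length_le hi k).trans (hk₀ i hi))) ▸ List.prefix_rfl

theorem PerformsRounds.decides {n d R : ℕ} {P : Protocol n (Pt d)}
    {hist : P.State → List (Finset (Tup n d) × Pt d)} {e : Execution P} {i : Fin n}
    {B : ℕ → Finset (Tup n d)} {v : ℕ → Pt d} (h : PerformsRounds hist e i R B v) :
    Decides e i (v R) := by
  classical
  obtain ⟨r, -, hmono, hle, hex, -, hdec⟩ := h
  refine ⟨Nat.find hex, fun k hk => ?_, fun k hk => ?_⟩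
  · rw [hdec, if_neg (Nat.find_min hex hk)]
  · rw [hdec, if_pos ((hle k).antisymm ((Nat.find_spec hex).ge.trans (hmono hk)))]

section Rounds

variable {n d f R : ℕ} {sel : Finset (Tup n d) → Pt d} {F : Finset (Fin n)} {x : Fin n → Pt d}

theorem vals_getElem?_succ (y : Pt d) (H : List (Finset (Tup n d) × Pt d)) (t : ℕ) :
    (vals y H)[t + 1]? = H[t]?.map Prod.snd := by
  simp [vals]

/-- If two processes complete a round, they share a non-faulty witness, and the `n - f` tuples of
its report belong to both of their sets.  A quorum of `ready` votes determines the point of a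
tuple, which for a non-faulty sender is the state that it has broadcast. -/
theorem Run.exchange {S : Fin n → ℕ → Local n d R} (h : Run f sel F x S) (hF : F.card ≤ f)
    (hn : 3 * f + 1 ≤ n) {k : ℕ} {r : Fin R} {u : Fin n → Pt d} {B : Fin n → Finset (Tup n d)}
    (hu : ∀ i, i ∉ F → (S i k).own.init r = some (u i))
    (hB : ∀ i, i ∉ F → ∃ y, Completed f sel F S k r (B i, y)) :
    Exchange f F (r + 1) u B := by
  classical
  have hoverlap : ∀ i, i ∉ F → ∀ j, j ∉ F → n - f ≤ (B i ∩ B j).card := by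
    intro i hi j hj
    obtain ⟨_, -, -, hwi⟩ := hB i hi
    obtain ⟨_, -, -, hwj⟩ := hB j hj
    obtain ⟨a, -, ⟨C, hC, hcard, hCi⟩, C', hC', -, hCj⟩ := hwi.exists_and hF hn hwj
    rw [hC] at hC'
    rw [← Option.some.inj hC'] at hCj
    exact hcard.trans (Finset.card_le_card (Finset.subset_inter hCi hCj))
  refine
    { round_eq := fun i hi τ hτ => ?_
      card_ge := fun i hi => ?_
      overlap := fun i hi j hj => ?_
      unique := fun i hi τ hτ σ hσ hne hp => hne ?_
      correct := fun i hi τ hτ hq => ?_ }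
  · obtain ⟨_, -, hv, -⟩ := hB i hi
    exact (hv τ hτ).1
  · exact (hoverlap i hi i hi).trans (Finset.card_le_card Finset.inter_subset_left)
  · convert hoverlap i hi j hj
  · obtain ⟨_, -, hv, -⟩ := hB i hi
    obtain ⟨h1, h2⟩ := hv τ hτ
    obtain ⟨h3, h4⟩ := hv σ hσ
    rw [← hp] at h4
    obtain ⟨a, ha, haτ, haσ⟩ := h2.exists_and hF hn h4
    have hpt := Option.some.inj (haτ.symm.trans haσ)
    cases τ; cases σ
    simp_all
  · obtain ⟨_, -, hv, -⟩ := hB i hi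
    obtain ⟨a, ha, har⟩ := (hv τ hτ).2.exists hF hn
    have h1 := h.ready_correct hF hn ha hq har
    rw [hu _ hq] at h1
    exact (Option.some.inj h1).symm

/-- The rounds of an admissible execution of `proto`: each one begins with an exchange, averages
the selected points, keeps the states in the convex hull and shrinks the spread. -/
theorem exists_rounds (hn : 3 * f + 1 ≤ n) (hnf : (d + 2) * f + 1 ≤ n)
    (hsel : ∀ C, (Gam f (Phi C)).Nonempty → sel C ∈ Gam f (Phi C)) (hF : F.card ≤ f)
    {e : Execution (proto n d f R sel)} (he : Admissible (proto n d f R sel) F x e) :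
    ∃ (B : Fin n → ℕ → Finset (Tup n d)) (v : Fin n → ℕ → Pt d),
      (∀ i, i ∉ F → v i 0 = x i) ∧
      (∀ i, i ∉ F → PerformsRounds (P := proto n d f R sel) Local.hist e i R (B i) (v i)) ∧
      ∀ t, 1 ≤ t → t ≤ R →
        Exchange f F t (fun i => v i (t - 1)) (fun i => B i t) ∧
        (∀ i, i ∉ F → ∀ C ⊆ B i t, C.card = n - f → sel C ∈ Gam f (Phi C)) ∧
        (∀ i, i ∉ F → v i t = average f sel (B i t)) ∧
        (∀ i, i ∉ F → v i t ∈ convexHull ℝ (nonfaulty F fun j => v j (t - 1))) ∧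
        ∀ l, spread F (fun i => v i t) l ≤
          (1 - gam n f) * spread F (fun i => v i (t - 1)) l := by
  have h := he.run
  obtain ⟨k₀, H, hH⟩ := h.exists_final hF hn
  let B : Fin n → ℕ → Finset (Tup n d) := fun i t => ((H i)[t - 1]?.map Prod.fst).getD ∅
  let v : Fin n → ℕ → Pt d := fun i t => ((vals (x i) (H i))[t]?).getD 0
  have hv0 : ∀ i, v i 0 = x i := fun i => rfl
  have hentry : ∀ i, i ∉ F → ∀ t, t < R → (H i)[t]? = some (B i (t + 1), v i (t + 1)) := by
    intro i hi t ht
    have hlt : t < (H i).length := by rw [(hH i hi).1]; exact ht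
    simp [B, v, vals_getElem?_succ, List.getElem?_eq_getElem hlt]
  have hvals : ∀ i, i ∉ F → ∀ t, t ≤ R → (vals (x i) (H i))[t]? = some (v i t) := by
    intro i hi t ht
    have hlt : t < (vals (x i) (H i)).length := by
      rw [vals, List.length_cons, List.length_map, (hH i hi).1]; omega
    simp [v, List.getElem?_eq_getElem hlt]
  refine ⟨B, v, fun i _ => hv0 i, fun i hi => ?_, fun t ht1 htR => ?_⟩
  · obtain ⟨hlen, hk₀, hpre⟩ := hH i hi
    refine ⟨fun k => (locals e i k).hist.length, ?_,
      fun k k' hk => (h.hist_prefix hi hk).length_le, fun k => h.hist_length_le hi k,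
      ⟨k₀, by simp only [hk₀, hlen]⟩, fun k => ?_, fun k => ?_⟩
    · simp only [h.init i hi]
      rfl
    · refine List.ext_getElem? fun t => ?_
      change (locals e i k).hist[t]? = _
      rcases lt_or_ge t (locals e i k).hist.length with hlt | hge
      · have h1 := List.getElem?_eq_getElem hlt
        have h2 := hentry i hi t (hlt.trans_le (h.hist_length_le hi k))
        rw [getElem?_of_prefix (hpre k) h1] at h2
        rw [h1, h2]
        simp [hlt]
      · rw [List.getElem?_eq_none hge, List.getElem?_eq_none (by simpa using hge)]
    · change (if (locals e i k).hist.length = R then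
        (vals (locals e i k).input (locals e i k).hist)[R]? else none) = _
      split
      · rename_i hR
        rw [h.input_eq hi, (hpre k).eq_of_length (hR.trans hlen.symm), hvals i hi R le_rfl]
      · rfl
  · obtain ⟨s, rfl⟩ : ∃ s, t = s + 1 := ⟨t - 1, by omega⟩
    have hcompl : ∀ i, i ∉ F →
        Run.Completed f sel F (locals e) k₀ ⟨s, htR⟩ (B i (s + 1), v i (s + 1)) := fun i hi =>
      h.hist_sound (by omega) hi k₀ (by rw [(hH i hi).2.1]; exact hentry i hi s htR)
    have hex : Exchange f F (s + 1) (fun i => v i s) (fun i => B i (s + 1)) :=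
      h.exchange hF hn (k := k₀) (r := ⟨s, htR⟩)
        (fun i hi => by
          rw [h.own_init hi, (hH i hi).2.1]
          exact hvals i hi s (Nat.le_of_succ_le htR))
        fun i hi => ⟨_, hcompl i hi⟩
    have hgam : ∀ C : Finset (Tup n d), C.card = n - f → sel C ∈ Gam f (Phi C) :=
      fun C hC => sel_mem_gam hsel hnf hC
    have hhull : ∀ i, i ∉ F → ∀ C ⊆ B i (s + 1), C.card = n - f →
        sel C ∈ convexHull ℝ (nonfaulty F fun j => v j s) := fun i hi C hC hCc =>
      hex.sel_mem_convexHull hF hi hC (hgam C hCc)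
    have havg : ∀ i, i ∉ F → v i (s + 1) = average f sel (B i (s + 1)) := fun i hi =>
      (hcompl i hi).1
    have hne : ∃ i, i ∉ F := exists_notMem_of_card_lt (by omega)
    refine ⟨hex, fun _ _ C _ hC => hgam C hC, havg, fun i hi => ?_, fun l => ?_⟩
    · rw [havg i hi]
      exact average_mem (convex_convexHull ℝ _) (hex.card_ge i hi) (hhull i hi)
    · exact hex.spread_average_le hne hhull havg l

end Rounds

end BVC

open BVC
theorem theorem4 (n d f : ℕ) (hn : 1 < n) (hd : 0 < d) (hnf : (d + 2) * f + 1 ≤ n)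
    (ε ν U : ℝ) (hε : 0 < ε)
    (sel : Finset (Tup n d) → Pt d)
    (hsel : ∀ C, (Gam f (Phi C)).Nonempty → sel C ∈ Gam f (Phi C)) :
    ∃ (P : Protocol n (Pt d)) (hist : P.State → List (Finset (Tup n d) × Pt d)),
      SolvesApproxBVC P f ε ν U ∧
      ∀ F : Finset (Fin n), F.card ≤ f → ∀ x : Fin n → Pt d, InputsBounded ν U F x →
        ∀ e : Execution P, Admissible P F x e →
          ∃ (B : Fin n → ℕ → Finset (Tup n d)) (v : Fin n → ℕ → Pt d),
            (∀ i, i ∉ F → v i 0 = x i) ∧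
            (∀ i, i ∉ F → PerformsRounds hist e i (numRounds n f ε ν U) (B i) (v i)) ∧
            ∀ t, 1 ≤ t → t ≤ numRounds n f ε ν U →
              Exchange f F t (fun i => v i (t - 1)) (fun i => B i t) ∧
              (∀ i, i ∉ F → ∀ C ⊆ B i t, C.card = n - f → sel C ∈ Gam f (Phi C)) ∧
              (∀ i, i ∉ F → v i t = average f sel (B i t)) ∧
              (∀ i, i ∉ F → v i t ∈ convexHull ℝ (nonfaulty F fun j => v j (t - 1))) ∧
              ∀ l, spread F (fun i => v i t) l ≤
                (1 - gam n f) * spread F (fun i => v i (t - 1)) l := by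
  have h3 : 3 * f + 1 ≤ n := by
    have : 3 * f ≤ (d + 2) * f := Nat.mul_le_mul_right f (by omega)
    omega
  refine ⟨proto n d f (numRounds n f ε ν U) sel, Local.hist, ?_,
    fun F hF x _ e he => exists_rounds h3 hnf hsel hF he⟩
  intro F hF x hx e he
  obtain ⟨B, v, hv0, hper, hround⟩ := exists_rounds h3 hnf hsel hF he
  have hne : ∃ i, i ∉ F := exists_notMem_of_card_lt (by omega)
  have hU : ν ≤ U := by
    obtain ⟨i, hi⟩ := hne
    exact (hx i hi ⟨0, hd⟩).1.trans (hx i hi ⟨0, hd⟩).2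
  have hg : 0 ≤ 1 - gam n f := by linarith [gam_lt_one (f := f) hn]
  have hspread : ∀ l t, t ≤ numRounds n f ε ν U →
      spread F (fun i => v i t) l ≤ (1 - gam n f) ^ t * (U - ν) := by
    intro l t
    induction t with
    | zero =>
      intro _
      rw [pow_zero, one_mul]
      refine spread_le hne fun i hi j hj => ?_
      rw [hv0 i hi, hv0 j hj]
      linarith [(hx i hi l).2, (hx j hj l).1]
    | succ t ih =>
      intro ht
      refine ((hround (t + 1) (by omega) ht).2.2.2.2 l).trans ?_
      rw [pow_succ', mul_assoc]
      exact mul_le_mul_of_nonneg_left (ih (by omega)) hg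
  have hvalid : ∀ t, t ≤ numRounds n f ε ν U → ∀ i, i ∉ F →
      v i t ∈ convexHull ℝ (nonfaulty F x) := by
    intro t
    induction t with
    | zero => exact fun _ i hi => subset_convexHull ℝ _ ⟨i, hi, (hv0 i hi).symm⟩
    | succ t ih =>
      intro ht i hi
      refine convexHull_min ?_ (convex_convexHull ℝ _)
        ((hround (t + 1) (by omega) ht).2.2.2.1 i hi)
      rintro _ ⟨j, hj, rfl⟩
      exact ih (by omega) j hj
  refine ⟨fun i => v i (numRounds n f ε ν U), fun i hi => (hper i hi).decides,
    fun i hi j hj l => ?_, hvalid _ le_rfl⟩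
  exact ((abs_sub_le_spread (v := fun i => v i _) hi hj l).trans (hspread l _ le_rfl)).trans
    (pow_numRounds_mul_le hn hε hU)
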